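/- Let $1\le k\le n-1$, $\epsilon_i=1$ for $i\le n-k$, $\epsilon_i=-1$ for $i>n-k$, $J=\mathrm{diag}(\epsilon_1,\dots,\epsilon_n)$, and let $U\subset\mathbb R^n$ be open and simply connected with $0\in U$. All maps are $C^\infty$. **Definitions.** An isothermic$_k$ hypersurface on an open set $W$ is an immersion $f:W\to\mathbb R^{n+1}$ whose coordinates are line of curvature coordinates (first and second fundamental forms diagonal), with $\sum_i\epsilon_i|f_{x_i}|^2=0$. A Combescure sequence of isothermic$_k$ hypersurfaces on $W$ is a sequence $f_1,\dots,f_n$ of these such that $(f_\ell)_{x_j}$ and $(f_{\ell+1})_{x_j}$ are parallel for all $j$ and $\ell<n$, and such that there are metric fields $\vec u_\ell=(u_{\ell1},\dots,u_{\ell n})^T$, i.e. $\mathrm I_{f_\ell}=\sum_j u_{\ell j}^2dx_j^2$, with $(f_\ell)_{x_j}/u_{\ell j}$ independent of $\ell$, which are linearly independent at every point. A map $f(x)\mapsto\tilde f(x)$ between hypersurfaces in line of curvature coordinates on $W$ is a Ribaucour transform if there are orthonormal frames $(e_a)$, $(\tilde e_a)$, $1\le a\le n+1$, with $e_i\parallel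 f_{x_i}$, $\tilde e_i\parallel\tilde f_{x_i}$ for $i\le n$, and functions $h_a$ with $f+h_ae_a=\tilde f+h_a\tilde e_a$ for $1\le a\le n+1$. **Data.** Let $f_1,\dots,f_n$ be a Combescure sequence of isothermic$_k$ hypersurfaces on $U$ with $f_\ell(0)=0$ and $(f_1)_{x_i}(0)$ parallel to the $i$-th standard basis vector, $1\le i\le n$. Let $\vec u_\ell$ be metric fields as above, $e_i=(f_1)_{x_i}/u_{1i}$ for $i\le n$, and $e_{n+1}$ a unit normal field. Put $f_{ij}=-\epsilon_i(u_{1i})_{x_j}/u_{1j}$ for $i\ne j$, $f_{ii}=0$, $F=(f_{ij})$, and $\gamma_i=\epsilon_ih_i$, where $\langle d^2f_1,e_{n+1}\rangle=\sum_iu_{1i}h_i\,dx_i^2$. With $\delta=\mathrm{diag}(dx_1,\dots,dx_n)$ let $$\theta_\lambda=\begin{pmatrix}\omega&-\lambda\binom{\delta}{0}J\\ \lambda(\delta,0)&\tau\end{pmatrix},\quad \omega=\begin{pmatrix}-\delta JF+F^TJ\delta&-\delta J\gamma\\ \gamma^TJ\delta&0\end{pmatrix},\quad \tau=(F\delta-\delta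 F^T)J .$$ On $\mathbb C^{2n+1}=\mathbb C^{n+1}\oplus\mathbb C^n$ use the bilinear form $\sum_aA_aA'_a+\sum_i\epsilon_iB_iB'_i$ and $\rho(A,B)=(A,-B)$. Condition (R) on $\alpha\in\mathbb C\setminus\{0\}$ and $w\ne0$ says that $w$ is null and either $\alpha\in\mathbb R$ and $w\in\mathbb R^{n+1}\oplus\mathbb R^n$, or $\alpha\in i\mathbb R$ and $w\in\mathbb R^{n+1}\oplus i\mathbb R^n$. Let $\alpha$, $v$ satisfy (R) and $\rho\langle v\rangle\ne\langle v\rangle$. **Theorem.** $(F,\gamma)$ is a solution of the $\frac{\mathrm O(2n+1-k,k)}{\mathrm O(n+1)\times\mathrm O(n-k,k)}$-system, i.e. $\theta_\lambda$ is flat ($d\theta_\lambda+\theta_\lambda\wedge\theta_\lambda=0$) for all $\lambda\in\mathbb C$. The system $dy=-\theta_\alpha y$, $y(0)=v$, has a unique solution $y:U\to\mathbb C^{2n+1}$. Moreover: 1. $y(x)$ satisfies (R) for all $x\in U$; the set $B=\{x\in U:\rho\langle y(x)\rangle\ne\langle y(x)\rangle\}$ is open and contains $0$; and for $x\in B$ there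 are $Q(x)\in\mathbb R^{n+1}$ and $Z(x)$, in $\mathbb R^n$ if $\alpha\in\mathbb R$ and in $i\mathbb R^n$ if $\alpha\in i\mathbb R$, with $\langle y(x)\rangle=\langle\binom{Q(x)}{Z(x)}\rangle$, $\sum_aQ_a^2=2$ and $\sum_i\epsilon_iZ_i^2=-2$. For any such choice of $Q=(q_1,\dots,q_{n+1})^T$ and $Z$ on $B$ put $$\tilde f_\ell=f_\ell+\frac{Z^T\vec u_\ell}{\alpha}\sum_{j=1}^{n+1}q_je_j,\qquad 1\le\ell\le n .$$ The factors $Z^T\vec u_\ell/\alpha$ are real, and the maps $\tilde f_\ell$ are smooth on $B$. 2. For each $\ell$, $\tilde f_\ell$ is an isothermic$_k$ hypersurface on the open subset of $B$ where it is an immersion, and $f_\ell(x)\mapsto\tilde f_\ell(x)$ is a Ribaucour transform on the part of that subset where no $q_a$ vanishes. 3. $\{\tilde f_1,\dots,\tilde f_n\}$ is a Combescure sequence of isothermic$_k$ hypersurfaces on the open subset of $B$ where all $\tilde f_\ell$ are immersions. On all of $B$ there are a smooth orthonormal frame $\tilde e_1,\dots,\tilde e_{n+1}$ and smooth $\tilde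 u_\ell=(\tilde u_{\ell1},\dots,\tilde u_{\ell n})$, linearly independent at every point, with $(\tilde f_\ell)_{x_j}=\tilde u_{\ell j}\tilde e_j$, $\sum_j\epsilon_j\tilde u_{\ell j}^2=0$, $(\tilde e_{n+1})_{x_j}\parallel\tilde e_j$, and $q_a(\tilde f_\ell-f_\ell)=\frac{Z^T\vec u_\ell}{\alpha}(e_a-\tilde e_a)$ for $1\le a\le n+1$. -/

import Mathlib

open scoped ContDiff RealInnerProductSpace

noncomputable section

namespace Isothermic

/-- Euclidean space `ℝⁿ`. -/
abbrev E (n : ℕ) : Type := EuclideanSpace ℝ (Fin n)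

/-- Labels of the `n + 1` vectors of an adapted frame of a hypersurface: `Sum.inl i` is the `i`-th
tangent direction, `Sum.inr ()` is the `(n+1)`-st, normal, direction. -/
abbrev FrameIdx (n : ℕ) : Type := Fin n ⊕ Unit

/-- The index set of `ℂ^{2n+1} = ℂ^{n+1} ⊕ ℂ^n`. -/
abbrev BigIdx (n : ℕ) : Type := FrameIdx n ⊕ Fin n

/-- The partial derivative `∂g/∂x_i` at `x`. -/
def pd {n : ℕ} {V : Type*} [NormedAddCommGroup V] [NormedSpace ℝ V]
    (i : Fin n) (g : E n → V) (x : E n) : V :=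
  fderiv ℝ g x (EuclideanSpace.single i 1)

/-- The signs `ε_1, …, ε_n`: the first `n - k` are `1`, the last `k` are `-1`. -/
def eps {n : ℕ} (k : ℕ) (i : Fin n) : ℝ := if (i : ℕ) + k < n then 1 else -1

/-- The matrix `J = I_{n-k,k} = diag(ε_1, …, ε_n)`. -/
def Jmat (n k : ℕ) : Matrix (Fin n) (Fin n) ℝ := Matrix.diagonal (eps k)

/-! ### Hypersurfaces in line of curvature coordinates -/

/-- `f` is an immersion at the point `x`. -/
def ImmersedAt {n : ℕ} (f : E n → E (n + 1)) (x : E n) : Prop :=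
  LinearIndependent ℝ (fun i : Fin n => pd i f x)

/-- `f : U → ℝ^{n+1}` is a smooth immersed hypersurface, and the coordinates of the open set `U` are
line of curvature coordinates: both fundamental forms are diagonal. -/
structure IsCurvatureLineParam {n : ℕ} (U : Set (E n)) (f : E n → E (n + 1)) : Prop where
  isOpen : IsOpen U
  smooth : ContDiffOn ℝ ∞ f U
  immersed : ∀ x ∈ U, ImmersedAt f x
  first_diag : ∀ x ∈ U, ∀ i j : Fin n, i ≠ j → ⟪pd i f x, pd j f x⟫ = 0
  second_diag : ∀ x ∈ U, ∀ ν : E (n + 1), (∀ i : Fin n, ⟪pd i f x, ν⟫ = 0) →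
    ∀ i j : Fin n, i ≠ j → ⟪pd i (pd j f) x, ν⟫ = 0

/-- `f` is an isothermic`_k` hypersurface parametrised by line of curvature coordinates on `U`: the
induced metric is diagonal and `g_11 + … + g_{n-k,n-k} = g_{n-k+1,n-k+1} + … + g_nn`. -/
structure IsIsothermic {n : ℕ} (k : ℕ) (U : Set (E n)) (f : E n → E (n + 1)) : Prop extends
    IsCurvatureLineParam U f where
  guichard : ∀ x ∈ U, ∑ i : Fin n, eps k i * ⟪pd i f x, pd i f x⟫ = 0

/-- `f(x) ↦ f'(x)` is a Combescure transform: corresponding coordinate tangent vectors are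
parallel. (It is used for immersions only, so all these vectors are non-zero.) -/
def IsCombescureTransform {n : ℕ} (U : Set (E n)) (f f' : E n → E (n + 1)) : Prop :=
  ∀ x ∈ U, ∀ j : Fin n, ∃ c : ℝ, pd j f' x = c • pd j f x

/-- Smooth metric fields `u_ℓ = (u_ℓ1, …, u_ℓn)` of `f_1, …, f_n`, that is `I_{f_ℓ} = ∑ u_ℓj² dx_j²`,
chosen so that `(f_ℓ)_{x_j} / u_ℓj` does not depend on `ℓ`. -/
structure IsMetricFields {n : ℕ} (U : Set (E n)) (f : Fin n → E n → E (n + 1))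
    (u : Fin n → E n → Fin n → ℝ) : Prop where
  smooth : ∀ l, ContDiffOn ℝ ∞ (u l) U
  sq_eq : ∀ l, ∀ x ∈ U, ∀ j, u l x j ^ 2 = ⟪pd j (f l) x, pd j (f l) x⟫
  compatible : ∀ l m, ∀ x ∈ U, ∀ j,
    (u l x j)⁻¹ • pd j (f l) x = (u m x j)⁻¹ • pd j (f m) x

/-- `f_1, …, f_n` is a Combescure sequence of isothermic`_k` hypersurfaces on the open set `U`. -/
structure IsCombescureSequence {n : ℕ} (k : ℕ) (U : Set (E n)) (f : Fin n → E n → E (n + 1)) :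
    Prop where
  isothermic : ∀ l, IsIsothermic k U (f l)
  combescure : ∀ l m : Fin n, (m : ℕ) = (l : ℕ) + 1 → IsCombescureTransform U (f l) (f m)
  independent : ∃ u : Fin n → E n → Fin n → ℝ, IsMetricFields U f u ∧
    ∀ x ∈ U, LinearIndependent ℝ (fun l => u l x)

/-- `N` is a smooth unit normal field of the hypersurface `f` on `U`. -/
structure IsUnitNormal {n : ℕ} (U : Set (E n)) (f N : E n → E (n + 1)) : Prop where
  smooth : ContDiffOn ℝ ∞ N U
  unit : ∀ x ∈ U, ‖N x‖ = 1
  normal : ∀ x ∈ U, ∀ i : Fin n, ⟪pd i f x, N x⟫ = 0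

/-- `e_1, …, e_{n+1}` is a smooth orthonormal frame on `U` such that `e_1, …, e_n` are the directions
of the coordinate lines of the immersion `f` (so that `e_{n+1}` is a unit normal field). -/
structure IsAdaptedFrame {n : ℕ} (U : Set (E n)) (f : E n → E (n + 1))
    (e : FrameIdx n → E n → E (n + 1)) : Prop where
  smooth : ∀ a, ContDiffOn ℝ ∞ (e a) U
  orthonormal : ∀ x ∈ U, Orthonormal ℝ (fun a => e a x)
  tangent : ∀ x ∈ U, ∀ i : Fin n, ∃ c : ℝ, pd i f x = c • e (Sum.inl i) x

/-- `f(x) ↦ f'(x)` is a Ribaucour transform between hypersurfaces parametrised by line of curvature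
coordinates: principal directions `e_i` of `f` correspond to principal directions `e'_i` of `f'`,
the tangent lines in corresponding principal directions meet at equal distance `|h_i|`
(`1 ≤ i ≤ n`), and so do the normal lines (`i = n + 1`): the sphere with centre
`f + h_{n+1} e_{n+1} = f' + h_{n+1} e'_{n+1}` and radius `|h_{n+1}|` (which is not `0` where
`f ≠ f'`) is tangent to `f` and to `f'` at corresponding points. -/
structure IsRibaucourTransform {n : ℕ} (U : Set (E n)) (f f' : E n → E (n + 1)) : Prop where
  source : IsCurvatureLineParam U f
  target : IsCurvatureLineParam U f'
  meet : ∃ (e e' : FrameIdx n → E n → E (n + 1)) (h : FrameIdx n → E n → ℝ),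
    IsAdaptedFrame U f e ∧ IsAdaptedFrame U f' e' ∧ (∀ a, ContDiffOn ℝ ∞ (h a) U) ∧
    ∀ x ∈ U, ∀ a, f x + h a x • e a x = f' x + h a x • e' a x

/-! ### The associated solution and its Lax pair -/

/-- `F = (f_ij)` with `f_ij = -ε_i (u_i)_{x_j} / u_j` for `i ≠ j` and `f_ii = 0`. -/
def assocF {n : ℕ} (k : ℕ) (u : E n → Fin n → ℝ) (x : E n) : Matrix (Fin n) (Fin n) ℝ :=
  Matrix.of fun i j => if i = j then 0 else -eps k i * pd j (fun y => u y i) x / u x j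

/-- `γ_i = ε_i h_i`, where the second fundamental form with respect to the unit normal `N` is
`II = ⟨d²f, N⟩ = ∑ u_i h_i dx_i²`. -/
def assocGamma {n : ℕ} (k : ℕ) (f N : E n → E (n + 1)) (u : E n → Fin n → ℝ) (x : E n) :
    Fin n → ℝ :=
  fun i => eps k i * (⟪pd i (pd i f) x, N x⟫ / u x i)

/-- The coefficient of `dx_i` in `δ = diag(dx_1, …, dx_n)`. -/
def deltaCoeff {n : ℕ} (i : Fin n) : Matrix (Fin n) (Fin n) ℝ := Matrix.single i i 1

/-- The coefficient of `dx_i` in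
`ω = [[-δ J F + Fᵀ J δ, -δ J γ], [γᵀ J δ, 0]]`. -/
def omegaCoeff {n : ℕ} (k : ℕ) (F : Matrix (Fin n) (Fin n) ℝ) (γ : Fin n → ℝ) (i : Fin n) :
    Matrix (FrameIdx n) (FrameIdx n) ℝ :=
  Matrix.fromBlocks
    (-(deltaCoeff i * Jmat n k * F) + F.transpose * Jmat n k * deltaCoeff i)
    (Matrix.replicateCol Unit (-((deltaCoeff i * Jmat n k).mulVec γ)))
    (Matrix.replicateRow Unit (Matrix.vecMul γ (Jmat n k * deltaCoeff i)))
    0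

/-- The coefficient of `dx_i` in `τ = (F δ - δ Fᵀ) J`. -/
def tauCoeff {n : ℕ} (k : ℕ) (F : Matrix (Fin n) (Fin n) ℝ) (i : Fin n) :
    Matrix (Fin n) (Fin n) ℝ :=
  (F * deltaCoeff i - deltaCoeff i * F.transpose) * Jmat n k

/-- The coefficient of `dx_i` in the Lax pair
`θ_s = [[ω, -s (δ; 0) J], [s (δ, 0), τ]]` with spectral parameter `s`. -/
def laxCoeff {n : ℕ} (k : ℕ) (F : Matrix (Fin n) (Fin n) ℝ) (γ : Fin n → ℝ) (s : ℂ) (i : Fin n) :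
    Matrix (BigIdx n) (BigIdx n) ℂ :=
  Matrix.fromBlocks
    ((omegaCoeff k F γ i).map Complex.ofReal)
    (-(s • (Matrix.fromRows (deltaCoeff i * Jmat n k)
      (0 : Matrix Unit (Fin n) ℝ)).map Complex.ofReal))
    (s • (Matrix.fromCols (deltaCoeff i) (0 : Matrix (Fin n) Unit ℝ)).map Complex.ofReal)
    ((tauCoeff k F i).map Complex.ofReal)

/-- `(F, γ)` is a smooth solution on `U` of the system of `O(2n+1-k,k) / (O(n+1) × O(n-k,k))`: `F`
has zero diagonal and `θ_s` is flat, `dθ_s + θ_s ∧ θ_s = 0`, for every `s`. -/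
structure IsSystemSolution {n : ℕ} (k : ℕ) (U : Set (E n)) (F : E n → Matrix (Fin n) (Fin n) ℝ)
    (γ : E n → Fin n → ℝ) : Prop where
  smooth_F : ∀ i j, ContDiffOn ℝ ∞ (fun x => F x i j) U
  smooth_gamma : ∀ i, ContDiffOn ℝ ∞ (fun x => γ x i) U
  diag_zero : ∀ x ∈ U, ∀ i, F x i i = 0
  flat : ∀ s : ℂ, ∀ x ∈ U, ∀ (i j : Fin n) (a b : BigIdx n),
    pd i (fun x' => laxCoeff k (F x') (γ x') s j a b) x
      - pd j (fun x' => laxCoeff k (F x') (γ x') s i a b) x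
      + (laxCoeff k (F x) (γ x) s i * laxCoeff k (F x) (γ x) s j
        - laxCoeff k (F x) (γ x) s j * laxCoeff k (F x) (γ x) s i) a b = 0

/-- `y` solves `dy = -θ_s y` on `U` with `y(0) = v`. -/
structure IsLaxSolution {n : ℕ} (k : ℕ) (U : Set (E n)) (F : E n → Matrix (Fin n) (Fin n) ℝ)
    (γ : E n → Fin n → ℝ) (s : ℂ) (v : BigIdx n → ℂ) (y : E n → BigIdx n → ℂ) : Prop where
  differentiable : ∀ x ∈ U, DifferentiableAt ℝ y x
  deriv_eq : ∀ x ∈ U, ∀ i, pd i y x = -((laxCoeff k (F x) (γ x) s i).mulVec (y x))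
  initial : y 0 = v

/-! ### Isotropic lines and the reality condition -/

/-- The complex bilinear form of signature `(2n+1-k, k)` on `ℂ^{n+1} ⊕ ℂ^n`. -/
def bigForm {n : ℕ} (k : ℕ) (v w : BigIdx n → ℂ) : ℂ :=
  ∑ a, v (Sum.inl a) * w (Sum.inl a) + ∑ i, (eps k i : ℂ) * v (Sum.inr i) * w (Sum.inr i)

/-- The map `ρ = I_{n+1,n}`, `(A, B) ↦ (A, -B)`. -/
def rho (n : ℕ) : (BigIdx n → ℂ) →ₗ[ℂ] (BigIdx n → ℂ) :=
  Matrix.toLin' (Matrix.diagonal (Sum.elim (fun _ => 1) (fun _ => -1)))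

/-- The line `L = ⟨v⟩` is moved by `ρ`. -/
def LineMoved {n : ℕ} (v : BigIdx n → ℂ) : Prop :=
  (Submodule.span ℂ {v}).map (rho n) ≠ Submodule.span ℂ {v}

/-- The generator `v` of an isotropic line is non-zero and null, and either `α ∈ ℝ^×` and `v` is in
`ℝ^{n+1} ⊕ ℝ^n`, or `α ∈ iℝ^×` and `v` is in `ℝ^{n+1} ⊕ iℝ^n`. -/
structure IsRealIsotropic {n : ℕ} (k : ℕ) (α : ℂ) (v : BigIdx n → ℂ) : Prop where
  ne_zero : v ≠ 0
  isotropic : bigForm k v v = 0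
  param_ne_zero : α ≠ 0
  real_upper : ∀ a, (v (Sum.inl a)).im = 0
  reality : (α.im = 0 ∧ ∀ i, (v (Sum.inr i)).im = 0) ∨ (α.re = 0 ∧ ∀ i, (v (Sum.inr i)).re = 0)

/-- `⟨w⟩ = ⟨(Q, Z)⟩` with `(Q, Q)_0 = -(Z, Z)_k = 2`, where `Q` is real, and `Z` is real if `α` is
real and purely imaginary if `α` is. -/
structure IsNormalizedGenerator {n : ℕ} (k : ℕ) (α : ℂ) (w : BigIdx n → ℂ) (Q : FrameIdx n → ℝ)
    (Z : Fin n → ℂ) : Prop where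
  span_eq : Submodule.span ℂ {w} =
    Submodule.span ℂ {(Sum.elim (fun a => (Q a : ℂ)) Z : BigIdx n → ℂ)}
  norm_Q : ∑ a, Q a ^ 2 = 2
  norm_Z : ∑ i, (eps k i : ℂ) * Z i ^ 2 = -2
  real_Z : α.im = 0 → ∀ i, (Z i).im = 0
  imag_Z : α.re = 0 → ∀ i, (Z i).re = 0

/-! ### The transformed hypersurfaces -/

/-- The frame `e_i = f_{x_i} / u_i` (`1 ≤ i ≤ n`), `e_{n+1} = N`. -/
def frame {n : ℕ} (f N : E n → E (n + 1)) (u : E n → Fin n → ℝ) (a : FrameIdx n) (x : E n) :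
    E (n + 1) :=
  Sum.elim (fun i => (u x i)⁻¹ • pd i f x) (fun _ => N x) a

/-- The scalar `Zᵀ u / α`. -/
def coefficient {n : ℕ} (α : ℂ) (Z : Fin n → ℂ) (u : Fin n → ℝ) : ℂ :=
  (∑ i, Z i * (u i : ℂ)) / α

/-- `f̃ = f + (Zᵀ u / α) ∑ q_j e_j`; the scalar is a real number for the data that occur. -/
def transform {n : ℕ} (α : ℂ) (f : E n → E (n + 1)) (u : E n → Fin n → ℝ)
    (e : FrameIdx n → E n → E (n + 1)) (Q : E n → FrameIdx n → ℝ) (Z : E n → Fin n → ℂ)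
    (x : E n) : E (n + 1) :=
  f x + (coefficient α (Z x) (u x)).re • ∑ a, Q x a • e a x

end Isothermic

end

/-!
The orthonormal frame `e` and the metric fields `u_ℓ` of a Combescure sequence are parallel for `ω`
and for `τ` respectively: `∂_i e_a = ∑_b ω_i(b, a) e_b` and `∂_j u_ℓi = ∑_m τ_j(m, i) u_ℓm`. For the
frame this uses that an array with three different indices which is symmetric in two of them and
antisymmetric in two others vanishes; for the metric fields the missing derivative `∂_i u_ℓi` comes
from differentiating `∑ ε_j u_ℓj² = 0` (`isFramedSequence_of_combescure`). A connection with a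
linearly independent family of parallel sections is flat (`flat_of_parallel_family`), so `ω` and `τ`
are flat, and since the commutators of `θ_λ` have no part depending on `λ` (`laxCoeff_commutator`)
`θ_λ` is flat for all `λ`. The system `dy = -θ_α y` is then solvable on a simply connected domain.
Near a point the parallel frame is obtained by integrating along rays (`exists_local_frame_zero`),
and globally by lifting the identity of `U` to the covering space of germs of parallel frames
(`exists_global_frame`). The quadratic form is a first integral because `θ_α` is skew for it, and
the reality condition is preserved by uniqueness of solutions.

Write `y = (A, α b)`; then `A` and `b` are real. Put `M = ∑ A_a e_a`, `φ_ℓ = bᵀ u_ℓ`, `m = α²` and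
`s = 2 / |A|²`. The linear system gives `∂_i M = m ε_i b_i e_i` and `∂_i φ_ℓ = -A_i u_ℓi`, because
the terms in `ω` and in `τ` cancel against the derivatives of `e` and of `u_ℓ`. A normalized
generator is `c (A, α b)` with a real factor such that `c² = s`, so the transform is
`f̃_ℓ = f_ℓ + s φ_ℓ M`.
Differentiating gives `∂_j f̃_ℓ = ũ_ℓj ẽ_j`, where `ẽ` is the image of `e` under the reflection in
the hyperplane `M^⊥` and `ũ_ℓ = u_ℓ + s m φ_ℓ J b`. The null condition `|A|² + m bᵀ J b = 0` makes
`u ↦ ũ` an isometric involution for `J`, hence `ũ_ℓ` is again null and the `ũ_ℓ` are again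
independent. The last frame vector satisfies `∂_j ẽ_{n+1} ∥ ẽ_j`, from which the vanishing of the
mixed second fundamental form follows (`IsFramedMap.isIsothermic`). Finally both `f̃_ℓ - f_ℓ` and
`e_a - ẽ_a = s A_a M` are multiples of `M`, which is the Ribaucour property.
-/

namespace Isothermic

open Set Filter Topology

/-! ### Integration of flat linear connections -/

section Flat

open MeasureTheory
open scoped unitInterval

/-- A family of continuous linear maps depending continuously on a compact parameter, as one
continuous linear map into the space of continuous functions. -/
noncomputable def evalFamily {K E F : Type*} [TopologicalSpace K] [CompactSpace K]
    [NormedAddCommGroup E] [NormedSpace ℝ E] [NormedAddCommGroup F] [NormedSpace ℝ F]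
    (L : C(K, E →L[ℝ] F)) : E →L[ℝ] C(K, F) :=
  LinearMap.mkContinuous
    { toFun := fun h => ⟨fun s => L s h, by fun_prop⟩
      map_add' := fun h h' => by ext s; simp
      map_smul' := fun c h => by ext s; simp } ‖L‖ (fun h => by
      refine (ContinuousMap.norm_le _ (by positivity)).2 fun s => ?_
      exact (L s).le_of_opNorm_le (L.norm_coe_le_norm s) h)

@[simp] theorem evalFamily_apply {K E F : Type*} [TopologicalSpace K] [CompactSpace K]
    [NormedAddCommGroup E] [NormedSpace ℝ E] [NormedAddCommGroup F] [NormedSpace ℝ F]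
    (L : C(K, E →L[ℝ] F)) (h : E) (s : K) : evalFamily L h s = L s h := rfl

/-- Differentiation under a compact parameter: if `∂a/∂x (x, s)` is jointly continuous, then
`x ↦ a x` is differentiable as a map into the space of continuous functions of `s`. -/
theorem hasFDerivAt_continuousMap {K E F : Type*} [TopologicalSpace K] [CompactSpace K]
    [NormedAddCommGroup E] [NormedSpace ℝ E] [NormedAddCommGroup F] [NormedSpace ℝ F]
    (P : E → C(K, F)) (a' : C(E × K, E →L[ℝ] F))
    (h : ∀ x s, HasFDerivAt (fun z => P z s) (a' (x, s)) x) (x₀ : E) :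
    HasFDerivAt P (evalFamily (a'.curry x₀)) x₀ := by
  rw [hasFDerivAt_iff_isLittleO, Asymptotics.isLittleO_iff]
  intro c hc
  have hcont : Tendsto (fun x => a'.curry x) (𝓝 x₀) (𝓝 (a'.curry x₀)) :=
    a'.curry.continuous.continuousAt
  rw [ContinuousMap.tendsto_iff_tendstoUniformly, Metric.tendstoUniformly_iff] at hcont
  obtain ⟨δ, hδ, hδ'⟩ := Metric.eventually_nhds_iff_ball.1 (hcont c hc)
  filter_upwards [Metric.ball_mem_nhds x₀ hδ] with x hx
  refine (ContinuousMap.norm_le _ (by positivity)).2 fun s => ?_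
  refine (convex_ball x₀ δ).norm_image_sub_le_of_norm_hasFDerivWithin_le'
    (f := fun z => P z s) (f' := fun z => a' (z, s)) (φ := a' (x₀, s))
    (fun z _ => (h z s).hasFDerivWithinAt) (fun z hz => ?_) (Metric.mem_ball_self hδ) hx
  have h1 := (hδ' z hz s).le
  rwa [dist_comm, dist_eq_norm] at h1

theorem hasFDerivAt_clm_comp {E X G : Type*} [NormedAddCommGroup E] [NormedSpace ℝ E]
    [NormedAddCommGroup X] [NormedSpace ℝ X] [NormedAddCommGroup G] [NormedSpace ℝ G]
    (L : X →L[ℝ] G) {Y : E → X} {Y' : E →L[ℝ] X} {x : E} (h : HasFDerivAt Y Y' x) :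
    HasFDerivAt (fun z => L (Y z)) (L.comp Y') x :=
  L.hasFDerivAt.comp x h

/-- The equation `Y + V (P Y) = 1` in a Banach algebra, depending on a parameter `x` through `P`, is
solvable near a zero of `P`, and its solution is as differentiable as `P`. -/
theorem exists_differentiable_solution {E : Type*} [NormedAddCommGroup E] [NormedSpace ℝ E]
    {X : Type*} [NormedRing X] [NormedAlgebra ℝ X] [CompleteSpace X] (V : X →L[ℝ] X) (P : E → X)
    (P' : E → E →L[ℝ] X) (hP : ∀ x, HasFDerivAt P (P' x) x) {x₀ : E} (hP0 : P x₀ = 0) :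
    ∃ (Y : E → X) (Y' : E → E →L[ℝ] X), Y x₀ = 1 ∧ ∀ᶠ x in 𝓝 x₀, HasFDerivAt Y (Y' x) x ∧
      Y x + V (P x * Y x) = 1 ∧ ∀ h, Y' x h + V (P' x h * Y x + P x * Y' x h) = 0 := by
  set T : E → (X →L[ℝ] X) := fun x => 1 + V.comp (ContinuousLinearMap.mul ℝ X (P x)) with hT
  have hTd : ∀ x, DifferentiableAt ℝ T x := by
    intro x
    have h1 : DifferentiableAt ℝ (fun x => ContinuousLinearMap.mul ℝ X (P x)) x :=
      ((ContinuousLinearMap.mul ℝ X).hasFDerivAt.comp x (hP x)).differentiableAt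
    exact (((hasFDerivAt_const V x).clm_comp h1.hasFDerivAt).differentiableAt).const_add 1
  have hT0 : T x₀ = 1 := by simp [hT, hP0]
  have hTu : ∀ᶠ x in 𝓝 x₀, IsUnit (T x) := by
    have h1 : {B : X →L[ℝ] X | IsUnit B} ∈ 𝓝 (T x₀) :=
      Units.isOpen.mem_nhds (by rw [hT0]; exact isUnit_one)
    exact (hTd x₀).continuousAt h1
  set Y : E → X := fun x => Ring.inverse (T x) 1 with hY
  have hYd : ∀ x, IsUnit (T x) → DifferentiableAt ℝ Y x := by
    intro x hx
    have h1 : DifferentiableAt ℝ (fun x => Ring.inverse (T x)) x :=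
      DifferentiableAt.fun_comp' x (differentiableAt_inverse (𝕜 := ℝ) hx) (hTd x)
    exact h1.clm_apply (differentiableAt_const _)
  have hYeq : ∀ x, IsUnit (T x) → Y x + V (P x * Y x) = 1 := fun x hx =>
    DFunLike.congr_fun (Ring.mul_inverse_cancel _ hx) (1 : X)
  refine ⟨Y, fderiv ℝ Y, by simp [hY, hT0], ?_⟩
  filter_upwards [hTu, hTu.eventually_nhds] with x hx2 hx3
  refine ⟨(hYd x hx2).hasFDerivAt, hYeq x hx2, fun h => ?_⟩
  have h1 := (hYd x hx2).hasFDerivAt.add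
    (V.hasFDerivAt.comp x ((hP x).mul' (hYd x hx2).hasFDerivAt))
  have h2 : HasFDerivAt (fun x => Y x + V (P x * Y x)) (0 : E →L[ℝ] X) x :=
    (hasFDerivAt_const (1 : X) x).congr_of_eventuallyEq (hx3.mono fun z hz => hYeq z hz)
  have h3 := DFunLike.congr_fun (h1.unique h2) h
  simpa [add_comm] using h3

section Volterra

variable {R : Type*} [NormedRing R] [NormedAlgebra ℝ R] [CompleteSpace R]

/-- The Volterra operator `Z ↦ (t ↦ ∫₀ᵗ Z)` on the continuous functions on `[0, 1]`. -/
noncomputable def volterra (R : Type*) [NormedRing R] [NormedAlgebra ℝ R] [CompleteSpace R] :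
    C(I, R) →L[ℝ] C(I, R) :=
  LinearMap.mkContinuous
    { toFun := fun Z => ⟨fun t => ∫ s in (0 : ℝ)..t, Z (projIcc 0 1 zero_le_one s), by
        have h : Continuous fun b : ℝ => ∫ s in (0 : ℝ)..b, Z (projIcc 0 1 zero_le_one s) :=
          intervalIntegral.continuous_primitive (fun a b => Continuous.intervalIntegrable
            (Z.continuous.comp continuous_projIcc) a b) 0
        exact h.comp continuous_subtype_val⟩
      map_add' := fun Z Z' => by
        ext t
        exact intervalIntegral.integral_add
          (Continuous.intervalIntegrable (Z.continuous.comp continuous_projIcc) _ _)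
          (Continuous.intervalIntegrable (Z'.continuous.comp continuous_projIcc) _ _)
      map_smul' := fun c Z => by
        ext t
        exact intervalIntegral.integral_smul c _ } 1 (fun Z => by
      refine (ContinuousMap.norm_le _ (by positivity)).2 fun t => ?_
      refine (intervalIntegral.norm_integral_le_of_norm_le_const
        (C := ‖Z‖) fun s _ => Z.norm_coe_le_norm _).trans ?_
      have h0 := t.2.1
      have h1 := t.2.2
      rw [sub_zero, abs_of_nonneg h0, one_mul]
      exact mul_le_of_le_one_right (norm_nonneg _) h1)

theorem volterra_apply (Z : C(I, R)) (t : I) :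
    volterra R Z t = ∫ s in (0 : ℝ)..t, Z (projIcc 0 1 zero_le_one s) := rfl

end Volterra

section Local

variable {E : Type*} [NormedAddCommGroup E] [NormedSpace ℝ E]
  {R : Type*} [NormedRing R] [NormedAlgebra ℝ R]

/-- The connection form `A` evaluated along the ray through `x`. -/
noncomputable def rayCoeff (A : E → E →L[ℝ] R) (hA : Continuous A) (x : E) : C(I, R) :=
  ⟨fun s => A ((s : ℝ) • x) x, by fun_prop⟩

theorem hasFDerivAt_rayCoeff {A : E → E →L[ℝ] R} (hA : ContDiff ℝ 1 A) (x : E) :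
    ∃ D : E →L[ℝ] C(I, R), HasFDerivAt (rayCoeff A hA.continuous) D x ∧
      ∀ h s, D h s = (s : ℝ) • fderiv ℝ A ((s : ℝ) • x) h x + A ((s : ℝ) • x) h := by
  have hfd : Continuous (fderiv ℝ A) := hA.continuous_fderiv one_ne_zero
  let a' : C(E × I, E →L[ℝ] R) :=
    ⟨fun p => (p.2 : ℝ) • (fderiv ℝ A ((p.2 : ℝ) • p.1)).flip p.1 + A ((p.2 : ℝ) • p.1), by
      have := hA.continuous
      have h1 : Continuous fun p : E × I => (fderiv ℝ A ((p.2 : ℝ) • p.1)).flip :=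
        (ContinuousLinearMap.flipₗᵢ ℝ E E R).continuous.comp
          (hfd.comp (by fun_prop))
      fun_prop⟩
  refine ⟨_, hasFDerivAt_continuousMap _ a' (fun z s => ?_) x, fun h s => ?_⟩
  · have h1 : HasFDerivAt (fun w : E => A ((s : ℝ) • w))
        ((fderiv ℝ A ((s : ℝ) • z)).comp ((s : ℝ) • ContinuousLinearMap.id ℝ E)) z :=
      HasFDerivAt.comp z ((hA.differentiable one_ne_zero) _).hasFDerivAt
        ((hasFDerivAt_id z).const_smul (s : ℝ))
    have h2 := h1.clm_apply (hasFDerivAt_id z)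
    refine h2.congr_fderiv ?_
    ext h
    simp [a', add_comm]
  · simp [a']

/-- A flat connection which is defined everywhere has a parallel frame near the origin. Flatness is
only needed near the origin. The frame is the solution of the ordinary differential equation along
the rays; the defect in the other directions solves a homogeneous linear equation along the rays. -/
theorem exists_local_frame_zero [CompleteSpace R] {A : E → E →L[ℝ] R} (hA : ContDiff ℝ 1 A)
    {r : ℝ} (hr : 0 < r)
    (flat : ∀ x ∈ Metric.ball (0 : E) r, ∀ h k, fderiv ℝ A x h k - fderiv ℝ A x k h
      + (A x h * A x k - A x k * A x h) = 0) :
    ∃ Φ : E → R, ∀ᶠ x in 𝓝 (0 : E), IsUnit (Φ x) ∧ DifferentiableAt ℝ Φ x ∧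
      ∀ h, fderiv ℝ Φ x h = -(A x h * Φ x) := by
  have hAc := hA.continuous
  set P := rayCoeff A hAc with hP
  choose P' hP' hP'eq using fun x => hasFDerivAt_rayCoeff hA x
  have hP0 : P 0 = 0 := by ext s; simp [hP, rayCoeff]
  obtain ⟨Y, Y', hY0, hY⟩ := exists_differentiable_solution (volterra R) P P' hP' hP0
  have hev : ∀ x, HasFDerivAt Y (Y' x) x →
      HasFDerivAt (fun x => Y x 1) ((ContinuousMap.evalCLM ℝ (1 : I)).comp (Y' x)) x :=
    fun x hx => hasFDerivAt_clm_comp (ContinuousMap.evalCLM ℝ (1 : I)) hx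
  refine ⟨fun x => Y x 1, ?_⟩
  have hΦ0 : Y 0 1 = 1 := by simp [hY0]
  have hΦu : ∀ᶠ x in 𝓝 (0 : E), IsUnit (Y x 1) := by
    have h1 : {B : R | IsUnit B} ∈ 𝓝 (Y 0 1) :=
      Units.isOpen.mem_nhds (by rw [hΦ0]; exact isUnit_one)
    exact (hev 0 hY.self_of_nhds.1).continuousAt h1
  filter_upwards [hΦu, hY, Metric.ball_mem_nhds (0 : E) hr] with x hx1 ⟨hYd, hYeq, hlin⟩ hxr
  refine ⟨hx1, (hev x hYd).differentiableAt, fun h => ?_⟩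
  have hDeq := hP'eq x
  set D := P' x
  set δ : C(I, R) := Y' x h with hδ
  have hder : fderiv ℝ (fun x => Y x 1) x h = δ 1 := by rw [(hev x hYd).fderiv]; rfl
  replace hlin : δ + volterra R (D h * Y x + P x * δ) = 0 := hlin h
  -- the integral equations extend the solution and its derivative to functions on the line
  have hprim : ∀ Z : C(I, R), ∀ t ∈ Icc (0 : ℝ) 1, HasDerivAt
      (fun b : ℝ => ∫ s in (0 : ℝ)..b, Z (projIcc 0 1 zero_le_one s))
      (Z (projIcc 0 1 zero_le_one t)) t := by
    intro Z t _
    have hc : Continuous fun s : ℝ => Z (projIcc 0 1 zero_le_one s) :=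
      Z.continuous.comp continuous_projIcc
    exact intervalIntegral.integral_hasDerivAt_right (hc.intervalIntegrable _ _)
      (hc.stronglyMeasurableAtFilter _ _) hc.continuousAt
  set y : ℝ → R := fun b => 1 - ∫ s in (0 : ℝ)..b, (P x * Y x) (projIcc 0 1 zero_le_one s)
  set d : ℝ → R := fun b =>
    -∫ s in (0 : ℝ)..b, (D h * Y x + P x * δ) (projIcc 0 1 zero_le_one s)
  have hyY : ∀ t : I, y t = Y x t := by
    intro t
    have h1 := DFunLike.congr_fun hYeq t
    rw [ContinuousMap.add_apply, volterra_apply] at h1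
    exact sub_eq_of_eq_add h1.symm
  have hdδ : ∀ t : I, d t = δ t := by
    intro t
    have h1 := DFunLike.congr_fun hlin t
    rw [ContinuousMap.add_apply, volterra_apply] at h1
    exact (eq_neg_of_add_eq_zero_left h1).symm
  have hy' : ∀ t ∈ Icc (0 : ℝ) 1, HasDerivAt y (-(A (t • x) x * y t)) t := by
    intro t ht
    have h1 := (hprim (P x * Y x) t ht).const_sub 1
    have h2 := hyY ⟨t, ht⟩
    rw [projIcc_of_mem _ ht, ContinuousMap.mul_apply, ← h2] at h1
    exact h1
  have hd' : ∀ t ∈ Icc (0 : ℝ) 1, HasDerivAt d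
      (-((t • fderiv ℝ A (t • x) h x + A (t • x) h) * y t + A (t • x) x * d t)) t := by
    intro t ht
    have h1 := (hprim (D h * Y x + P x * δ) t ht).neg
    have h2 := hyY ⟨t, ht⟩
    have h3 := hdδ ⟨t, ht⟩
    rw [projIcc_of_mem _ ht, ContinuousMap.add_apply, ContinuousMap.mul_apply,
      ContinuousMap.mul_apply, ← h2, ← h3, hDeq] at h1
    exact h1
  set z : ℝ → R := fun t => d t + t • (A (t • x) h * y t) with hz
  have hz' : ∀ t ∈ Icc (0 : ℝ) 1, HasDerivAt z (-(A (t • x) x * z t)) t := by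
    intro t ht
    have hray : HasDerivAt (fun t : ℝ => A (t • x) h) (fderiv ℝ A (t • x) x h) t := by
      have h1 : HasDerivAt (fun t : ℝ => t • x) x t := by
        simpa using (hasDerivAt_id t).smul_const x
      have h2 : HasDerivAt (fun t : ℝ => A (t • x)) (fderiv ℝ A (t • x) x) t :=
        ((hA.differentiable one_ne_zero) (t • x)).hasFDerivAt.comp_hasDerivAt t h1
      simpa using h2.clm_apply (hasDerivAt_const t h)
    have h1 := (hd' t ht).add ((hasDerivAt_id t).smul (hray.mul (hy' t ht)))
    refine h1.congr_deriv ?_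
    have htx : t • x ∈ Metric.ball (0 : E) r := by
      rw [mem_ball_zero_iff] at hxr ⊢
      rw [norm_smul, Real.norm_of_nonneg ht.1]
      exact (mul_le_of_le_one_left (norm_nonneg _) ht.2).trans_lt hxr
    have hfl := flat _ htx x h
    have hfl' : fderiv ℝ A (t • x) x h = fderiv ℝ A (t • x) h x
        - (A (t • x) x * A (t • x) h - A (t • x) h * A (t • x) x) := by
      rw [sub_add_eq_add_sub, sub_eq_zero] at hfl
      rw [← hfl]; abel
    simp only [id, hz, hfl', Pi.mul_apply, one_smul, smul_add, add_mul, mul_add, sub_mul, mul_neg,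
      smul_sub, smul_mul_assoc, mul_smul_comm, mul_assoc, smul_neg, neg_add]
    abel
  obtain ⟨K, hK⟩ : ∃ K : ℝ, ∀ t ∈ Icc (0 : ℝ) 1, ‖A (t • x) x‖ ≤ K :=
    isCompact_Icc.exists_bound_of_continuousOn (by fun_prop)
  have hz1 : z 1 = 0 := by
    refine eq_zero_of_abs_deriv_le_mul_abs_self_of_eq_zero_right (K := K) (a := 0) (b := 1)
      (f' := fun t => -(A (t • x) x * z t))
      (fun t ht => (hz' t ht).continuousAt.continuousWithinAt)
      (fun t ht => (hz' t (Ico_subset_Icc_self ht)).hasDerivWithinAt) (by simp [hz, d])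
      (fun t ht => ?_) 1 (right_mem_Icc.2 zero_le_one)
    rw [norm_neg]
    exact (norm_mul_le _ _).trans (by gcongr; exact hK t (Ico_subset_Icc_self ht))
  have h1 := hyY 1
  have h2 := hdδ 1
  rw [hder, ← h2]
  simp only [hz, one_smul] at hz1
  have : y 1 = Y x 1 := h1
  rw [← this]
  exact eq_neg_of_add_eq_zero_left hz1

end Local

end Flat

/-! ### Parallel frames over simply connected domains -/

section FlatGlobal

variable {E : Type*} [NormedAddCommGroup E] [NormedSpace ℝ E]
  {R : Type*} [NormedRing R] [NormedAlgebra ℝ R] [CompleteSpace R]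

/-- `Φ` is a frame of parallel sections of the connection `d + A` at the point `x`. -/
structure IsParallelFrameAt (A : E → E →L[ℝ] R) (Φ : E → R) (x : E) : Prop where
  isUnit : IsUnit (Φ x)
  differentiableAt : DifferentiableAt ℝ Φ x
  fderiv_apply : ∀ h, fderiv ℝ Φ x h = -(A x h * Φ x)

/-- A flat connection has a parallel frame near every point of its domain: translate the point to
the origin and extend the connection by a cutoff function, which is harmless because flatness is
needed only near the origin. -/
theorem exists_local_frame [FiniteDimensional ℝ E] {U : Set E} (hU : IsOpen U)
    {A : E → E →L[ℝ] R} (hA : ContDiffOn ℝ 1 A U)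
    (flat : ∀ x ∈ U, ∀ h k, fderiv ℝ A x h k - fderiv ℝ A x k h
      + (A x h * A x k - A x k * A x h) = 0) {p : E} (hp : p ∈ U) :
    ∃ r > 0, Metric.ball p r ⊆ U ∧ ∃ Φ : E → R, ∀ x ∈ Metric.ball p r,
      IsParallelFrameAt A Φ x := by
  obtain ⟨ε, hε, hεU⟩ := Metric.nhds_basis_closedBall.mem_iff.1 (hU.mem_nhds hp)
  let ψ : ContDiffBump p := ⟨ε / 2, ε, half_pos hε, half_lt_self hε⟩
  set A' : E → E →L[ℝ] R := fun y => ψ (p + y) • A (p + y) with hA'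
  have hA'c : ContDiff ℝ 1 A' := by
    have hglob : ContDiff ℝ 1 (fun y => ψ y • A y) := by
      rw [contDiff_iff_contDiffAt]
      intro x
      by_cases hx : x ∈ U
      · exact ψ.contDiff.contDiffAt.smul (hA.contDiffAt (hU.mem_nhds hx))
      · have h1 : (Metric.closedBall p ε)ᶜ ∈ 𝓝 x :=
          Metric.isClosed_closedBall.isOpen_compl.mem_nhds fun h => hx (hεU h)
        refine (contDiffAt_const (c := (0 : E →L[ℝ] R))).congr_of_eventuallyEq ?_
        filter_upwards [h1] with y hy
        have hy' : ε ≤ dist y p := le_of_lt (not_le.1 fun h => hy (Metric.mem_closedBall.2 h))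
        change ψ y • A y = 0
        rw [ψ.zero_of_le_dist hy']
        exact zero_smul ℝ (A y)
    exact hglob.comp (contDiff_const.add contDiff_id)
  have heq : ∀ y ∈ Metric.ball (0 : E) (ε / 2), A' =ᶠ[𝓝 y] fun y => A (p + y) := by
    intro y hy
    filter_upwards [Metric.isOpen_ball.mem_nhds hy] with z hz
    have : ψ (p + z) = 1 := ψ.one_of_mem_closedBall (by
      have := mem_ball_zero_iff.1 hz
      simpa [ψ] using this.le)
    simp [hA', this]
  have hmem : ∀ y ∈ Metric.ball (0 : E) (ε / 2), p + y ∈ U := by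
    intro y hy
    have := mem_ball_zero_iff.1 hy
    exact hεU (by simp; linarith)
  obtain ⟨Φ, hΦ⟩ := exists_local_frame_zero hA'c (half_pos hε) (fun x hx h k => by
    rw [(heq x hx).fderiv_eq, (heq x hx).self_of_nhds, fderiv_comp_add_left]
    exact flat _ (hmem x hx) h k)
  obtain ⟨δ, hδ, hδ'⟩ := Metric.eventually_nhds_iff_ball.1 hΦ
  refine ⟨min δ (ε / 2), lt_min hδ (half_pos hε), fun x hx => ?_, fun x => Φ (x - p),
    fun x hx => ?_⟩
  · have h1 : x - p ∈ Metric.ball (0 : E) (ε / 2) := by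
      rw [mem_ball_zero_iff, ← dist_eq_norm]; exact lt_of_lt_of_le hx (min_le_right _ _)
    simpa using hmem _ h1
  · have h1 : x - p ∈ Metric.ball (0 : E) (ε / 2) := by
      rw [mem_ball_zero_iff, ← dist_eq_norm]; exact lt_of_lt_of_le hx (min_le_right _ _)
    have h2 : x - p ∈ Metric.ball (0 : E) δ := by
      rw [mem_ball_zero_iff, ← dist_eq_norm]; exact lt_of_lt_of_le hx (min_le_left _ _)
    obtain ⟨hu, hd, hf⟩ := hδ' _ h2
    refine ⟨hu, ?_, fun h => ?_⟩
    · exact (differentiableAt_comp_sub p).2 hd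
    · rw [fderiv_comp_sub, hf, (heq _ h1).self_of_nhds]
      simp

/-- The quotient of two parallel frames has zero derivative. -/
theorem hasFDerivAt_inverse_mul {A : E → E →L[ℝ] R} {Φ Ψ : E → R} {x : E}
    (hΦ : IsParallelFrameAt A Φ x) (hΨd : DifferentiableAt ℝ Ψ x)
    (hΨ : ∀ h, fderiv ℝ Ψ x h = -(A x h * Ψ x)) :
    HasFDerivAt (fun y => Ring.inverse (Φ y) * Ψ y) (0 : E →L[ℝ] R) x := by
  obtain ⟨u, hu⟩ := hΦ.isUnit
  have h1 : HasFDerivAt (fun y => Ring.inverse (Φ y)) _ x :=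
    HasFDerivAt.comp (g := Ring.inverse) x (hu ▸ hasFDerivAt_ringInverse (𝕜 := ℝ) u)
      hΦ.differentiableAt.hasFDerivAt
  refine (h1.mul' hΨd.hasFDerivAt).congr_fderiv ?_
  ext h
  simp [hΦ.fderiv_apply, hΨ, ← hu, mul_assoc]

/-- The unit of the algebra given by an invertible value of a frame, `1` where it is not
invertible. -/
noncomputable def unitOf (Φ : E → R) (x : E) : Rˣ :=
  open Classical in if h : IsUnit (Φ x) then h.unit else 1

omit [CompleteSpace R] in
theorem IsParallelFrameAt.coe_unitOf {A : E → E →L[ℝ] R} {Φ : E → R} {x : E}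
    (h : IsParallelFrameAt A Φ x) : (unitOf Φ x : R) = Φ x := by
  rw [unitOf, dif_pos h.isUnit, IsUnit.unit_spec]

theorem unitOf_quotient_const {A : E → E →L[ℝ] R} {Φ Ψ : E → R} {C : Set E} (hC : IsOpen C)
    (hCc : Convex ℝ C) (hΦ : ∀ x ∈ C, IsParallelFrameAt A Φ x)
    (hΨ : ∀ x ∈ C, IsParallelFrameAt A Ψ x) {x y : E} (hx : x ∈ C) (hy : y ∈ C) :
    (unitOf Φ x)⁻¹ * unitOf Ψ x = (unitOf Φ y)⁻¹ * unitOf Ψ y := by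
  have hd : ∀ z ∈ C, HasFDerivAt (fun y => Ring.inverse (Φ y) * Ψ y) (0 : E →L[ℝ] R) z :=
    fun z hz => hasFDerivAt_inverse_mul (hΦ z hz) (hΨ z hz).differentiableAt (hΨ z hz).fderiv_apply
  have h := hC.is_const_of_fderiv_eq_zero (𝕜 := ℝ) hCc.isPreconnected
    (fun z hz => (hd z hz).differentiableAt.differentiableWithinAt)
    (fun z hz => (hd z hz).fderiv) hx hy
  have key : ∀ z ∈ C, Ring.inverse (Φ z) * Ψ z = ((unitOf Φ z)⁻¹ * unitOf Ψ z : Rˣ) := by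
    intro z hz
    rw [← (hΦ z hz).coe_unitOf, ← (hΨ z hz).coe_unitOf, Ring.inverse_unit, Units.val_mul]
  rw [key x hx, key y hy] at h
  exact Units.ext h

/-- A copy of `X` with the discrete topology. -/
@[ext] structure Discretized (X : Type*) where
  /-- The underlying element. -/
  val : X

instance (X : Type*) : TopologicalSpace (Discretized X) := ⊥

instance (X : Type*) : DiscreteTopology (Discretized X) := ⟨rfl⟩

/-- The covering space of germs of parallel frames of a flat connection: the coordinate changes of
local parallel frames are locally constant, so they glue copies of the discretized group of units.
-/
noncomputable def frameBundle {U : Set E} {A : E → E →L[ℝ] R} (r : U → ℝ) (Φ : U → E → R)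
    (hr : ∀ p, 0 < r p)
    (hΦ : ∀ p : U, ∀ x ∈ Metric.ball (p : E) (r p), IsParallelFrameAt A (Φ p) x) :
    FiberBundleCore U U (Discretized Rˣ) where
  baseSet p := Subtype.val ⁻¹' Metric.ball (p : E) (r p)
  isOpen_baseSet p := Metric.isOpen_ball.preimage continuous_subtype_val
  indexAt := id
  mem_baseSet_at p := Metric.mem_ball_self (hr p)
  coordChange p q x c := ⟨(unitOf (Φ q) x)⁻¹ * unitOf (Φ p) x * c.val⟩
  coordChange_self p x _ v := by simp
  continuousOn_coordChange p q := by
    rw [continuousOn_prod_of_discrete_right]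
    rintro c x ⟨hx, -⟩
    refine (continuousWithinAt_const
      (b := (⟨(unitOf (Φ q) x)⁻¹ * unitOf (Φ p) x * c.val⟩ : Discretized Rˣ))).congr
      (fun y hy => ?_) rfl
    have h := unitOf_quotient_const (A := A) (Φ := Φ q) (Ψ := Φ p)
      (C := Metric.ball (p : E) (r p) ∩ Metric.ball (q : E) (r q))
      (Metric.isOpen_ball.inter Metric.isOpen_ball)
      ((convex_ball _ _).inter (convex_ball _ _)) (fun z hz => hΦ q z hz.2)
      (fun z hz => hΦ p z hz.1) hy.1 hx
    simp only [h]
  coordChange_comp p q s x _ v := by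
    ext1
    simp only
    group

/-- A flat connection over a simply connected open set has a global parallel frame: the identity
lifts to the covering space of germs of parallel frames. -/
theorem exists_global_frame [FiniteDimensional ℝ E] {U : Set E} (hU : IsOpen U)
    (hUsc : IsSimplyConnected U) {A : E → E →L[ℝ] R} (hA : ContDiffOn ℝ 1 A U)
    (flat : ∀ x ∈ U, ∀ h k, fderiv ℝ A x h k - fderiv ℝ A x k h
      + (A x h * A x k - A x k * A x h) = 0) :
    ∃ Φ : E → R, ∀ x ∈ U, IsParallelFrameAt A Φ x := by
  have := hUsc.simplyConnectedSpace
  have := hU.locallyPathConnectedSpace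
  choose r hr _ Φ hΦ using fun p : U => exists_local_frame hU hA flat p.2
  set Z := frameBundle r Φ hr hΦ with hZ
  have hcov : IsCoveringMap Z.proj :=
    IsFiberBundle.isCoveringMap fun x => ⟨Z.localTrivAt x, Z.mem_localTrivAt_baseSet x⟩
  obtain ⟨p₀, hp₀⟩ := hUsc.nonempty
  obtain ⟨S, ⟨-, hS⟩, -⟩ := hcov.existsUnique_continuousMap_lifts (ContinuousMap.id U) ⟨p₀, hp₀⟩
    ⟨⟨p₀, hp₀⟩, (⟨1⟩ : Discretized Rˣ)⟩ rfl
  have hS' : ∀ x, (S x).1 = x := fun x => congrFun hS x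
  let c : U → Rˣ := fun x => Discretized.val (S x).2
  let Ψ : E → R := fun x => open Classical in
    if h : x ∈ U then (unitOf (Φ ⟨x, h⟩) x * c ⟨x, h⟩ : Rˣ) else 0
  refine ⟨Ψ, fun x hx => ?_⟩
  -- near `x` the lift is constant in the trivialization given by the frame centred at `x`.
  obtain ⟨d, hd⟩ : ∃ d : Rˣ, ∀ᶠ y in 𝓝 x, Ψ y = Φ ⟨x, hx⟩ y * d := by
    set t := Z.localTrivAt ⟨x, hx⟩ with ht
    have hcont : ContinuousAt (fun y : U => (t (S y)).2) ⟨x, hx⟩ := by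
      have h1 : ContinuousAt t (S ⟨x, hx⟩) := t.continuousAt (by
        rw [Bundle.Trivialization.mem_source]
        rw [hS']
        exact Z.mem_localTrivAt_baseSet _)
      exact continuous_snd.continuousAt.comp
        (ContinuousAt.comp (f := S) h1 S.continuous.continuousAt)
    have hconst : ∀ᶠ y : U in 𝓝 ⟨x, hx⟩, (t (S y)).2 = (t (S ⟨x, hx⟩)).2 :=
      hcont.eventually ((isOpen_discrete {(t (S ⟨x, hx⟩)).2}).mem_nhds rfl)
    have hball : ∀ᶠ y : U in 𝓝 ⟨x, hx⟩, (y : E) ∈ Metric.ball x (r ⟨x, hx⟩) :=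
      (Metric.isOpen_ball.preimage continuous_subtype_val).mem_nhds
        (Metric.mem_ball_self (hr ⟨x, hx⟩))
    refine ⟨Discretized.val (t (S ⟨x, hx⟩)).2, ?_⟩
    rw [← map_nhds_subtype_coe_eq_nhds hx (hU.mem_nhds hx), eventually_map]
    filter_upwards [hconst, hball] with y hy1 hy2
    rw [← hy1]
    have h3 : Discretized.val (t (S y)).2
        = (unitOf (Φ ⟨x, hx⟩) y)⁻¹ * unitOf (Φ y) y * c y := by
      have h4 : (t (S y)).2 = Z.coordChange (S y).1 ⟨x, hx⟩ (S y).1 (S y).2 := rfl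
      rw [h4, hS' y]
      rfl
    rw [h3, ← (hΦ ⟨x, hx⟩ y hy2).coe_unitOf, ← Units.val_mul]
    simp only [Ψ, dif_pos y.2]
    congr 1
    group
  have hΦx := hΦ ⟨x, hx⟩ x (Metric.mem_ball_self (hr _))
  have hder : HasFDerivAt Ψ _ x :=
    (hΦx.differentiableAt.hasFDerivAt.mul_const' (d : R)).congr_of_eventuallyEq hd
  refine ⟨?_, hder.differentiableAt, fun h => ?_⟩
  · rw [hd.self_of_nhds]
    exact hΦx.isUnit.mul d.isUnit
  · rw [hder.fderiv, hd.self_of_nhds]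
    simp [hΦx.fderiv_apply, mul_assoc]

end FlatGlobal

/-! ### Partial derivatives -/

section Pd

variable {n : ℕ} {V : Type*} [NormedAddCommGroup V] [NormedSpace ℝ V] {U : Set (E n)}

theorem fderiv_eq_sum_pd (g : E n → V) (x h : E n) :
    fderiv ℝ g x h = ∑ i, h i • pd i g x := by
  have h1 : h = ∑ i, h i • EuclideanSpace.single i (1 : ℝ) := by
    ext j; simp [Finset.sum_apply, Pi.single_apply]
  conv_lhs => rw [h1]
  simp [map_sum, pd]

theorem pd_congr {g g' : E n → V} {x : E n} (h : g =ᶠ[𝓝 x] g') (i : Fin n) :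
    pd i g x = pd i g' x := by
  rw [pd, pd, h.fderiv_eq]

theorem pd_congr_of_eqOn {g g' : E n → V} {x : E n} (hU : IsOpen U) (h : ∀ y ∈ U, g y = g' y)
    (hx : x ∈ U) (i : Fin n) : pd i g x = pd i g' x :=
  pd_congr (eventually_of_mem (hU.mem_nhds hx) h) i

theorem contDiffOn_pd (hU : IsOpen U) {g : E n → V} (hg : ContDiffOn ℝ ∞ g U) (i : Fin n) :
    ContDiffOn ℝ ∞ (pd i g) U :=
  ((hg.fderiv_of_isOpen hU (m := ∞) (by simp)).clm_apply contDiffOn_const)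

theorem differentiableAt_of_contDiffOn (hU : IsOpen U) {g : E n → V} (hg : ContDiffOn ℝ ∞ g U)
    {x : E n} (hx : x ∈ U) : DifferentiableAt ℝ g x :=
  (hg.contDiffAt (hU.mem_nhds hx)).differentiableAt (by simp)

theorem pd_comm (hU : IsOpen U) {g : E n → V} (hg : ContDiffOn ℝ ∞ g U) {x : E n} (hx : x ∈ U)
    (i j : Fin n) : pd i (pd j g) x = pd j (pd i g) x := by
  have hga := hg.contDiffAt (hU.mem_nhds hx)
  have hd : DifferentiableAt ℝ (fderiv ℝ g) x :=
    differentiableAt_of_contDiffOn hU (hg.fderiv_of_isOpen hU (m := ∞) (by simp)) hx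
  have key : ∀ v w : E n, fderiv ℝ (fun y => fderiv ℝ g y v) x w = fderiv ℝ (fderiv ℝ g) x w v := by
    intro v w
    have h := hd.hasFDerivAt.clm_apply (hasFDerivAt_const v x)
    rw [h.fderiv]; simp
  have hs : IsSymmSndFDerivAt ℝ g x := hga.isSymmSndFDerivAt (by
    rw [minSmoothness_of_isRCLikeNormedField]; exact WithTop.coe_le_coe.2 le_top)
  unfold pd
  rw [key, key]
  exact hs _ _

section Rules

variable {x : E n} (i : Fin n)

theorem pd_const (c : V) : pd i (fun _ : E n => c) x = 0 := by simp [pd]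

theorem pd_add {g g' : E n → V} (hg : DifferentiableAt ℝ g x) (hg' : DifferentiableAt ℝ g' x) :
    pd i (fun y => g y + g' y) x = pd i g x + pd i g' x := by
  simp [pd, fderiv_fun_add hg hg']

theorem pd_sub {g g' : E n → V} (hg : DifferentiableAt ℝ g x) (hg' : DifferentiableAt ℝ g' x) :
    pd i (fun y => g y - g' y) x = pd i g x - pd i g' x := by
  simp [pd, fderiv_fun_sub hg hg']

theorem pd_sum {ι : Type*} (s : Finset ι) {g : ι → E n → V}
    (hg : ∀ a ∈ s, DifferentiableAt ℝ (g a) x) :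
    pd i (fun y => ∑ a ∈ s, g a y) x = ∑ a ∈ s, pd i (g a) x := by
  simp [pd, fderiv_fun_sum hg]

theorem pd_smul {c : E n → ℝ} {g : E n → V} (hc : DifferentiableAt ℝ c x)
    (hg : DifferentiableAt ℝ g x) :
    pd i (fun y => c y • g y) x = c x • pd i g x + pd i c x • g x := by
  simp [pd, fderiv_fun_smul hc hg]

theorem pd_mul {A : Type*} [NormedCommRing A] [NormedAlgebra ℝ A] {c g : E n → A}
    (hc : DifferentiableAt ℝ c x) (hg : DifferentiableAt ℝ g x) :
    pd i (fun y => c y * g y) x = c x * pd i g x + pd i c x * g x := by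
  simp [pd, fderiv_fun_mul hc hg, mul_comm (g x)]

theorem pd_const_mul {A : Type*} [NormedCommRing A] [NormedAlgebra ℝ A] (c : A) {g : E n → A}
    (hg : DifferentiableAt ℝ g x) : pd i (fun y => c * g y) x = c * pd i g x := by
  rw [pd_mul i (differentiableAt_const c) hg, pd_const, zero_mul, add_zero]

theorem pd_inner {W : Type*} [NormedAddCommGroup W] [InnerProductSpace ℝ W] {g g' : E n → W}
    (hg : DifferentiableAt ℝ g x) (hg' : DifferentiableAt ℝ g' x) :
    pd i (fun y => ⟪g y, g' y⟫) x = ⟪g x, pd i g' x⟫ + ⟪pd i g x, g' x⟫ := by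
  simp [pd, fderiv_inner_apply ℝ hg hg']

theorem pd_clm {W : Type*} [NormedAddCommGroup W] [NormedSpace ℝ W] (L : V →L[ℝ] W) {g : E n → V}
    (hg : DifferentiableAt ℝ g x) : pd i (fun y => L (g y)) x = L (pd i g x) := by
  have h : HasFDerivAt (fun y => L (g y)) (L.comp (fderiv ℝ g x)) x :=
    L.hasFDerivAt.comp x hg.hasFDerivAt
  simp [pd, h.fderiv]

theorem pd_ofReal {g : E n → ℝ} (hg : DifferentiableAt ℝ g x) :
    pd i (fun y => (g y : ℂ)) x = ((pd i g x : ℝ) : ℂ) :=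
  pd_clm i Complex.ofRealCLM hg

theorem pd_pi {ι : Type*} [Fintype ι] {W : ι → Type*} [∀ a, NormedAddCommGroup (W a)]
    [∀ a, NormedSpace ℝ (W a)] {g : E n → ∀ a, W a} (hg : DifferentiableAt ℝ g x) (a : ι) :
    pd i (fun y => g y a) x = pd i g x a :=
  pd_clm i (ContinuousLinearMap.proj (R := ℝ) (φ := W) a) hg

end Rules

/-- A function with vanishing partial derivatives on a connected open set is constant. -/
theorem eqOn_const_of_pd_eq_zero (hU : IsOpen U) (hUc : IsPreconnected U) {g : E n → V}
    (hg : ∀ x ∈ U, DifferentiableAt ℝ g x) (hd : ∀ x ∈ U, ∀ i, pd i g x = 0) {x y : E n}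
    (hx : x ∈ U) (hy : y ∈ U) : g x = g y := by
  refine hU.is_const_of_fderiv_eq_zero (𝕜 := ℝ) hUc
    (fun z hz => (hg z hz).differentiableWithinAt) (fun z hz => ?_) hx hy
  ext h
  simp [fderiv_eq_sum_pd, hd z hz]

end Pd

/-! ### Linear systems with flat coefficients -/

section System

variable {n : ℕ} {U : Set (E n)}

/-- The connection form with components `C i`. -/
noncomputable def connectionForm {R : Type*} [NormedRing R] [NormedAlgebra ℝ R]
    (C : Fin n → E n → R) (x : E n) : E n →L[ℝ] R :=
  ∑ i, (EuclideanSpace.proj i : E n →L[ℝ] ℝ).smulRight (C i x)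

theorem connectionForm_apply {R : Type*} [NormedRing R] [NormedAlgebra ℝ R]
    (C : Fin n → E n → R) (x h : E n) : connectionForm C x h = ∑ i, h i • C i x := by
  simp [connectionForm]

/-- A flat connection on a simply connected open set, given by its components, has a global parallel
frame. -/
theorem exists_frame_of_flat {R : Type*} [NormedRing R] [NormedAlgebra ℝ R] [CompleteSpace R]
    (hU : IsOpen U) (hUsc : IsSimplyConnected U) {C : Fin n → E n → R}
    (hC : ∀ i, ContDiffOn ℝ ∞ (C i) U)
    (flat : ∀ x ∈ U, ∀ i j, pd i (C j) x - pd j (C i) x + (C i x * C j x - C j x * C i x) = 0) :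
    ∃ Φ : E n → R, ∀ x ∈ U, IsParallelFrameAt (connectionForm C) Φ x := by
  have hsm : ContDiffOn ℝ ∞ (connectionForm C) U := by
    unfold connectionForm
    refine ContDiffOn.sum fun i _ => ?_
    exact ((ContinuousLinearMap.smulRightL ℝ (E n) R
      (EuclideanSpace.proj i : E n →L[ℝ] ℝ)).contDiff.comp_contDiffOn (hC i))
  refine exists_global_frame hU hUsc (hsm.of_le (by simp)) fun x hx h k => ?_
  have hd : ∀ h k, fderiv ℝ (connectionForm C) x h k = ∑ i, ∑ j, (h i * k j) • pd i (C j) x := by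
    intro h k
    have h1 : fderiv ℝ (fun y => connectionForm C y k) x h
        = fderiv ℝ (connectionForm C) x h k := by
      have h2 := (differentiableAt_of_contDiffOn hU hsm hx).hasFDerivAt.clm_apply
        (hasFDerivAt_const k x)
      rw [h2.fderiv]; simp
    rw [← h1, fderiv_eq_sum_pd]
    simp only [connectionForm_apply]
    refine Finset.sum_congr rfl fun i _ => ?_
    rw [pd_sum i _ (g := fun j y => k j • C j y) fun j _ =>
      (differentiableAt_of_contDiffOn hU (hC j) hx).const_smul (k j),
      Finset.smul_sum]
    refine Finset.sum_congr rfl fun j _ => ?_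
    rw [pd_smul i (differentiableAt_const (k j)) (differentiableAt_of_contDiffOn hU (hC j) hx),
      pd_const, zero_smul, add_zero, smul_smul]
  have hm : ∀ h k, connectionForm C x h * connectionForm C x k
      = ∑ i, ∑ j, (h i * k j) • (C i x * C j x) := by
    intro h k
    simp only [connectionForm_apply, Finset.sum_mul_sum, smul_mul_smul_comm]
  rw [hd, hd, hm, hm, Finset.sum_comm (f := fun i j => (k i * h j) • pd i (C j) x),
    Finset.sum_comm (f := fun i j => (k i * h j) • (C i x * C j x)),
    ← Finset.sum_sub_distrib, ← Finset.sum_sub_distrib, ← Finset.sum_add_distrib]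
  refine Finset.sum_eq_zero fun i _ => ?_
  rw [← Finset.sum_sub_distrib, ← Finset.sum_sub_distrib, ← Finset.sum_add_distrib]
  refine Finset.sum_eq_zero fun j _ => ?_
  rw [mul_comm (k j), ← smul_sub, ← smul_sub, ← smul_add, flat x hx i j, smul_zero]

/-- Existence and uniqueness for the total linear system `∂y/∂x_i = -C_i y` with flat
coefficients. -/
theorem linearSystem_existsUnique {W : Type*} [NormedAddCommGroup W] [NormedSpace ℝ W]
    [CompleteSpace W] (hU : IsOpen U) (hUsc : IsSimplyConnected U) {C : Fin n → E n → W →L[ℝ] W}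
    (hC : ∀ i, ContDiffOn ℝ ∞ (C i) U)
    (flat : ∀ x ∈ U, ∀ i j, pd i (C j) x - pd j (C i) x + (C i x * C j x - C j x * C i x) = 0)
    {p : E n} (hp : p ∈ U) :
    (∀ v : W, ∃ y : E n → W, y p = v ∧ ∀ x ∈ U, DifferentiableAt ℝ y x ∧
      ∀ i, pd i y x = -(C i x (y x))) ∧
    ∀ y y' : E n → W,
      (∀ x ∈ U, DifferentiableAt ℝ y x ∧ ∀ i, pd i y x = -(C i x (y x))) →
      (∀ x ∈ U, DifferentiableAt ℝ y' x ∧ ∀ i, pd i y' x = -(C i x (y' x))) →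
      ∀ q ∈ U, y q = y' q → EqOn y y' U := by
  obtain ⟨Φ, hΦ⟩ := exists_frame_of_flat hU hUsc hC flat
  have hΦpd : ∀ x ∈ U, ∀ i, pd i Φ x = -(C i x * Φ x) := by
    intro x hx i
    rw [pd, (hΦ x hx).fderiv_apply, connectionForm_apply]
    simp
  constructor
  · intro v
    refine ⟨fun x => Φ x (Ring.inverse (Φ p) v), ?_, fun x hx => ⟨?_, fun i => ?_⟩⟩
    · exact DFunLike.congr_fun (Ring.mul_inverse_cancel _ (hΦ p hp).isUnit) v
    · exact (hΦ x hx).differentiableAt.clm_apply (differentiableAt_const _)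
    · have h := pd_clm i (ContinuousLinearMap.apply ℝ W (Ring.inverse (Φ p) v))
        (hΦ x hx).differentiableAt
      simp only [ContinuousLinearMap.apply_apply, hΦpd x hx] at h
      rw [h]; rfl
  · intro y y' hy hy' q hq hqq x hx
    have key : ∀ z : E n → W,
        (∀ x ∈ U, DifferentiableAt ℝ z x ∧ ∀ i, pd i z x = -(C i x (z x))) → ∀ x ∈ U,
        HasFDerivAt (fun x => Ring.inverse (Φ x) (z x)) (0 : E n →L[ℝ] W) x := by
      intro z hz x hx
      obtain ⟨u, hu⟩ := (hΦ x hx).isUnit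
      have h1 : HasFDerivAt (fun y => Ring.inverse (Φ y)) _ x :=
        HasFDerivAt.comp (g := Ring.inverse) x (hu ▸ hasFDerivAt_ringInverse (𝕜 := ℝ) u)
          (hΦ x hx).differentiableAt.hasFDerivAt
      refine (h1.clm_apply (hz x hx).1.hasFDerivAt).congr_fderiv ?_
      have h2 : ∀ w, (↑u⁻¹ : W →L[ℝ] W) ((u : W →L[ℝ] W) w) = w := fun w =>
        DFunLike.congr_fun u.inv_mul w
      have h2' : ∀ w, (u : W →L[ℝ] W) ((↑u⁻¹ : W →L[ℝ] W) w) = w := fun w =>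
        DFunLike.congr_fun u.mul_inv w
      ext h
      have h3 : fderiv ℝ z x h = -(connectionForm C x h (z x)) := by
        rw [fderiv_eq_sum_pd, connectionForm_apply]
        simp [(hz x hx).2, Finset.sum_neg_distrib]
      simp [(hΦ x hx).fderiv_apply, h3, ← hu, h2']
    have hconst : ∀ z : E n → W,
        (∀ x ∈ U, DifferentiableAt ℝ z x ∧ ∀ i, pd i z x = -(C i x (z x))) →
        Ring.inverse (Φ x) (z x) = Ring.inverse (Φ q) (z q) := fun z hz =>
      hU.is_const_of_fderiv_eq_zero (𝕜 := ℝ) hUsc.isPathConnected.isConnected.isPreconnected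
        (fun w hw => (key z hz w hw).differentiableAt.differentiableWithinAt)
        (fun w hw => (key z hz w hw).fderiv) hx hq
    have h1 : Ring.inverse (Φ x) (y x) = Ring.inverse (Φ x) (y' x) := by
      rw [hconst y hy, hconst y' hy', hqq]
    have h2 := Ring.mul_inverse_cancel _ (hΦ x hx).isUnit
    calc y x = (Φ x * Ring.inverse (Φ x)) (y x) := by rw [h2]; rfl
      _ = (Φ x * Ring.inverse (Φ x)) (y' x) := by
        rw [mul_apply_eq_comp, mul_apply_eq_comp, h1]
      _ = y' x := by rw [h2]; rfl

end System

/-! ### The Lax pair -/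

section LaxPair

variable {n : ℕ} (k : ℕ)

theorem eps_mul_self (i : Fin n) : eps k i * eps k i = 1 := by
  unfold eps; split_ifs <;> norm_num

theorem deltaCoeff_mul_apply (A : Matrix (Fin n) (Fin n) ℝ) (i p q : Fin n) :
    (deltaCoeff i * A) p q = if p = i then A i q else 0 := by
  rcases eq_or_ne p i with rfl | h
  · simp [deltaCoeff]
  · simp [deltaCoeff, h]

theorem mul_deltaCoeff_apply (A : Matrix (Fin n) (Fin n) ℝ) (i p q : Fin n) :
    (A * deltaCoeff i) p q = if q = i then A p i else 0 := by
  rcases eq_or_ne q i with rfl | h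
  · simp [deltaCoeff]
  · simp [deltaCoeff, h]

theorem Jmat_mul_apply (A : Matrix (Fin n) (Fin n) ℝ) (p q : Fin n) :
    (Jmat n k * A) p q = eps k p * A p q := by simp [Jmat]

theorem mul_Jmat_apply (A : Matrix (Fin n) (Fin n) ℝ) (p q : Fin n) :
    (A * Jmat n k) p q = A p q * eps k q := by simp [Jmat]

variable (F : Matrix (Fin n) (Fin n) ℝ) (γ : Fin n → ℝ) (i p q : Fin n)

theorem omegaCoeff_inl_inl : omegaCoeff k F γ i (Sum.inl p) (Sum.inl q)
    = -(if p = i then eps k i * F i q else 0) + if q = i then F i p * eps k i else 0 := by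
  simp only [omegaCoeff, Matrix.fromBlocks_apply₁₁, Matrix.add_apply, Matrix.neg_apply,
    Matrix.mul_assoc, deltaCoeff_mul_apply, Jmat_mul_apply]
  simp only [← Matrix.mul_assoc, mul_deltaCoeff_apply, mul_Jmat_apply, Matrix.transpose_apply]

theorem deltaCoeff_mul_Jmat_apply : (deltaCoeff i * Jmat n k) p q
    = if p = i ∧ q = i then eps k i else 0 := by
  rw [deltaCoeff_mul_apply, Jmat, Matrix.diagonal_apply]
  grind

theorem omegaCoeff_inl_inr (w : Unit) : omegaCoeff k F γ i (Sum.inl p) (Sum.inr w)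
    = -(if p = i then eps k i * γ i else 0) := by
  simp only [omegaCoeff, Matrix.fromBlocks_apply₁₂, Matrix.replicateCol_apply, Pi.neg_apply,
    Matrix.mulVec, dotProduct, deltaCoeff_mul_Jmat_apply]
  by_cases hp : p = i <;> simp [hp]

theorem omegaCoeff_inr_inl (w : Unit) : omegaCoeff k F γ i (Sum.inr w) (Sum.inl q)
    = if q = i then eps k i * γ i else 0 := by
  simp only [omegaCoeff, Matrix.fromBlocks_apply₂₁, Matrix.replicateRow_apply,
    Matrix.vecMul, dotProduct, mul_deltaCoeff_apply]
  by_cases hp : q = i <;> simp [hp, Jmat, Matrix.diagonal_apply, mul_comm]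

theorem omegaCoeff_inr_inr (w w' : Unit) : omegaCoeff k F γ i (Sum.inr w) (Sum.inr w') = 0 := rfl

theorem tauCoeff_apply : tauCoeff k F i p q
    = (if q = i then F p i * eps k i else 0) - if p = i then F q i * eps k q else 0 := by
  simp only [tauCoeff, mul_Jmat_apply, Matrix.sub_apply, mul_deltaCoeff_apply,
    deltaCoeff_mul_apply, Matrix.transpose_apply]
  by_cases hp : p = i <;> by_cases hq : q = i <;> simp [hp, hq]

theorem omegaCoeff_antisymm (a b : FrameIdx n) :
    omegaCoeff k F γ i a b = -omegaCoeff k F γ i b a := by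
  rcases a with p | w <;> rcases b with q | w'
  · rw [omegaCoeff_inl_inl, omegaCoeff_inl_inl]
    by_cases hp : p = i <;> by_cases hq : q = i <;> simp [hp, hq, mul_comm]
  · rw [omegaCoeff_inl_inr, omegaCoeff_inr_inl]
  · rw [omegaCoeff_inl_inr, omegaCoeff_inr_inl, neg_neg]
  · simp [omegaCoeff_inr_inr]

theorem tauCoeff_eps_antisymm :
    eps k p * tauCoeff k F i p q = -(eps k q * tauCoeff k F i q p) := by
  rw [tauCoeff_apply, tauCoeff_apply]
  by_cases hp : p = i <;> by_cases hq : q = i <;> simp [hp, hq] <;> ring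

/-- Expansion of a vector in an orthonormal frame. -/
theorem _root_.Orthonormal.sum_inner_smul {g : FrameIdx n → E (n + 1)} (hg : Orthonormal ℝ g)
    (w : E (n + 1)) : w = ∑ a, ⟪g a, w⟫ • g a := by
  have hcard : Fintype.card (FrameIdx n) = Module.finrank ℝ (E (n + 1)) := by simp
  have hspan : ⊤ ≤ Submodule.span ℝ (Set.range g) :=
    (hg.linearIndependent.span_eq_top_of_card_eq_finrank' hcard).ge
  have h := (OrthonormalBasis.mk hg hspan).sum_repr w
  simpa [OrthonormalBasis.repr_apply_apply] using h.symm

/-- The off-diagonal block `(δ; 0) J` of the Lax pair. -/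
def upperBlock (n k : ℕ) (i : Fin n) : Matrix (FrameIdx n) (Fin n) ℝ :=
  Matrix.fromRows (deltaCoeff i * Jmat n k) 0

/-- The off-diagonal block `(δ, 0)` of the Lax pair. -/
def lowerBlock (n : ℕ) (i : Fin n) : Matrix (Fin n) (FrameIdx n) ℝ :=
  Matrix.fromCols (deltaCoeff i) 0

theorem upperBlock_inl : upperBlock n k i (Sum.inl p) q = if p = i ∧ q = i then eps k i else 0 :=
  deltaCoeff_mul_Jmat_apply k i p q

theorem upperBlock_inr (w : Unit) : upperBlock n k i (Sum.inr w) q = 0 := rfl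

theorem lowerBlock_inl : lowerBlock n i p (Sum.inl q) = if p = i ∧ q = i then 1 else 0 := by
  change deltaCoeff i p q = _
  have := deltaCoeff_mul_apply 1 i p q
  rw [mul_one] at this
  rw [this, Matrix.one_apply]
  grind

theorem lowerBlock_inr (w : Unit) : lowerBlock n i p (Sum.inr w) = 0 := rfl

theorem upperBlock_mul_lowerBlock_comm (i j : Fin n) :
    upperBlock n k i * lowerBlock n j = upperBlock n k j * lowerBlock n i := by
  ext (p | _) (q | _) <;>
    simp [Matrix.mul_apply, upperBlock_inl, upperBlock_inr, lowerBlock_inl, lowerBlock_inr,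
      ite_and]
  grind

theorem lowerBlock_mul_upperBlock_comm (i j : Fin n) :
    lowerBlock n i * upperBlock n k j = lowerBlock n j * upperBlock n k i := by
  ext p q
  simp [Matrix.mul_apply, upperBlock_inl, upperBlock_inr, lowerBlock_inl, lowerBlock_inr, ite_and]
  grind

theorem omegaCoeff_mul_upperBlock_comm (i j : Fin n) :
    omegaCoeff k F γ i * upperBlock n k j + upperBlock n k i * tauCoeff k F j
      = omegaCoeff k F γ j * upperBlock n k i + upperBlock n k j * tauCoeff k F i := by
  ext (p | _) q
  · simp [Matrix.mul_apply, upperBlock_inl, upperBlock_inr, omegaCoeff_inl_inl,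
      tauCoeff_apply, ite_and]
    by_cases h1 : p = i <;> by_cases h2 : p = j <;> by_cases h3 : q = i <;> by_cases h4 : q = j <;>
      by_cases h5 : i = j <;> simp_all <;> ring
  · simp [Matrix.mul_apply, upperBlock_inl, upperBlock_inr, omegaCoeff_inr_inl, ite_and]
    grind

theorem lowerBlock_mul_omegaCoeff_comm (i j : Fin n) :
    lowerBlock n i * omegaCoeff k F γ j + tauCoeff k F i * lowerBlock n j
      = lowerBlock n j * omegaCoeff k F γ i + tauCoeff k F j * lowerBlock n i := by
  ext p (q | _)
  · simp [Matrix.mul_apply, lowerBlock_inl, lowerBlock_inr, omegaCoeff_inl_inl,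
      tauCoeff_apply, ite_and]
    by_cases h1 : p = i <;> by_cases h2 : p = j <;> by_cases h3 : q = i <;> by_cases h4 : q = j <;>
      by_cases h5 : i = j <;> simp_all
  · simp [Matrix.mul_apply, lowerBlock_inl, lowerBlock_inr, omegaCoeff_inl_inr, ite_and]
    grind

theorem laxCoeff_eq (s : ℂ) : laxCoeff k F γ s i = Matrix.fromBlocks
    ((omegaCoeff k F γ i).map Complex.ofRealHom) (-(s • (upperBlock n k i).map Complex.ofRealHom))
    (s • (lowerBlock n i).map Complex.ofRealHom) ((tauCoeff k F i).map Complex.ofRealHom) := rfl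

/-- The commutator of two components of the Lax pair has no off-diagonal blocks and does not depend
on the spectral parameter. -/
theorem laxCoeff_commutator (s : ℂ) (i j : Fin n) :
    laxCoeff k F γ s i * laxCoeff k F γ s j - laxCoeff k F γ s j * laxCoeff k F γ s i
      = Matrix.fromBlocks
        ((omegaCoeff k F γ i * omegaCoeff k F γ j - omegaCoeff k F γ j * omegaCoeff k F γ i).map
          Complex.ofRealHom) 0 0
        ((tauCoeff k F i * tauCoeff k F j - tauCoeff k F j * tauCoeff k F i).map
          Complex.ofRealHom) := by
  have hm : ∀ {l m o : Type} [Fintype m] (A : Matrix l m ℝ) (B : Matrix m o ℝ),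
      A.map Complex.ofRealHom * B.map Complex.ofRealHom = (A * B).map Complex.ofRealHom :=
    fun A B => (Matrix.map_mul).symm
  have ha : ∀ {l m : Type} (A B : Matrix l m ℝ),
      A.map Complex.ofRealHom + B.map Complex.ofRealHom = (A + B).map Complex.ofRealHom :=
    fun A B => (Matrix.map_add _ (map_add _) A B).symm
  simp only [laxCoeff_eq, Matrix.fromBlocks_multiply, sub_eq_add_neg,
    Matrix.fromBlocks_neg, Matrix.fromBlocks_add, Matrix.mul_neg,
    Matrix.neg_mul, Matrix.smul_mul, Matrix.mul_smul, hm]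
  have hn : ∀ {l m : Type} (A : Matrix l m ℝ),
      (-A).map Complex.ofRealHom = -A.map Complex.ofRealHom :=
    fun A => Matrix.map_neg _ (map_neg _) A
  congr 1
  · rw [upperBlock_mul_lowerBlock_comm k i j, ← ha, hn]
    abel
  · have h := congrArg (fun M => M.map Complex.ofRealHom)
      (omegaCoeff_mul_upperBlock_comm k F γ i j)
    simp only [← ha] at h
    simp only [← neg_add, ← smul_add]
    rw [h]
    abel
  · have h := congrArg (fun M => M.map Complex.ofRealHom)
      (lowerBlock_mul_omegaCoeff_comm k F γ i j)
    simp only [← ha] at h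
    rw [← smul_add, ← smul_add, h]
    abel
  · rw [lowerBlock_mul_upperBlock_comm k i j, ← ha, hn]
    abel

end LaxPair

section Flatness

variable {n : ℕ}

/-- A linearly independent family which is parallel for a connection makes the connection flat. -/
theorem flat_of_parallel_family {ι V : Type*} [Fintype ι] [NormedAddCommGroup V] [NormedSpace ℝ V]
    {U : Set (E n)} (hU : IsOpen U) {g : ι → E n → V} {W : Fin n → E n → Matrix ι ι ℝ}
    (hg : ∀ a, ContDiffOn ℝ ∞ (g a) U)
    (hW : ∀ i a b, ContDiffOn ℝ ∞ (fun y => W i y a b) U)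
    (hind : ∀ x ∈ U, LinearIndependent ℝ (fun a => g a x))
    (hd : ∀ x ∈ U, ∀ i a, pd i (g a) x = ∑ b, W i x b a • g b x) {x : E n} (hx : x ∈ U)
    (i j : Fin n) (a b : ι) :
    pd i (fun y => W j y a b) x - pd j (fun y => W i y a b) x
      + (W i x * W j x - W j x * W i x) a b = 0 := by
  have key : ∀ i j : Fin n, pd i (pd j (g b)) x
      = ∑ c, (pd i (fun y => W j y c b) x + (W i x * W j x) c b) • g c x := by
    intro i j
    have hWd := fun c => differentiableAt_of_contDiffOn hU (hW j c b) hx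
    have hgd := fun c => differentiableAt_of_contDiffOn hU (hg c) hx
    rw [pd_congr_of_eqOn hU (fun y hy => hd y hy j b) hx i,
      pd_sum i _ (g := fun c y => W j y c b • g c y) fun c _ => (hWd c).smul (hgd c)]
    simp only [pd_smul i (hWd _) (hgd _), hd x hx, add_smul, Finset.sum_add_distrib,
      Finset.smul_sum, smul_smul, Matrix.mul_apply, Finset.sum_smul]
    rw [add_comm, Finset.sum_comm]
    simp only [mul_comm]
  have h := pd_comm hU (hg b) hx i j
  rw [key, key, ← sub_eq_zero, ← Finset.sum_sub_distrib] at h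
  simp only [← sub_smul] at h
  have h1 := Fintype.linearIndependent_iff.1 (hind x hx) _ h a
  rw [Matrix.sub_apply]
  linarith

end Flatness

/-! ### Structure equations of a Combescure sequence -/

/-- A Combescure sequence `f` of isothermic`_k` hypersurfaces together with its common orthonormal
frame `e`, its metric fields `u` and its structure equations: `e` is parallel for `ω` and
`(u_1, …, u_n)` is parallel for `τ`. -/
structure IsFramedSequence {n : ℕ} (k : ℕ) (U : Set (E n)) (f : Fin n → E n → E (n + 1))
    (u : Fin n → E n → Fin n → ℝ) (e : FrameIdx n → E n → E (n + 1))
    (F : E n → Matrix (Fin n) (Fin n) ℝ) (γ : E n → Fin n → ℝ) : Prop where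
  isOpen : IsOpen U
  isothermic : ∀ l, IsIsothermic k U (f l)
  smooth_u : ∀ l i, ContDiffOn ℝ ∞ (fun x => u l x i) U
  smooth_e : ∀ a, ContDiffOn ℝ ∞ (e a) U
  smooth_F : ∀ i j, ContDiffOn ℝ ∞ (fun x => F x i j) U
  smooth_gamma : ∀ i, ContDiffOn ℝ ∞ (fun x => γ x i) U
  diag_zero : ∀ x ∈ U, ∀ i, F x i i = 0
  orthonormal : ∀ x ∈ U, Orthonormal ℝ (fun a => e a x)
  pd_f : ∀ x ∈ U, ∀ l j, pd j (f l) x = u l x j • e (Sum.inl j) x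
  pd_e : ∀ x ∈ U, ∀ i a, pd i (e a) x = ∑ b, omegaCoeff k (F x) (γ x) i b a • e b x
  pd_u : ∀ x ∈ U, ∀ l j i, pd j (fun y => u l y i) x = ∑ m, tauCoeff k (F x) j m i * u l x m
  null_u : ∀ x ∈ U, ∀ l, ∑ j, eps k j * u l x j ^ 2 = 0
  independent : ∀ x ∈ U, LinearIndependent ℝ (fun l => u l x)

section Structure

variable {n k : ℕ} {U : Set (E n)} {f : Fin n → E n → E (n + 1)} {u : Fin n → E n → Fin n → ℝ}

theorem IsMetricFields.ne_zero (hu : IsMetricFields U f u) (hf : ∀ l, IsIsothermic k U (f l))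
    (l : Fin n) {x : E n} (hx : x ∈ U) (j : Fin n) : u l x j ≠ 0 := by
  intro h
  have h1 := hu.sq_eq l x hx j
  rw [h, zero_pow two_ne_zero, real_inner_self_eq_norm_sq, eq_comm, sq_eq_zero_iff,
    norm_eq_zero] at h1
  exact ((hf l).immersed x hx).ne_zero j h1

/-- Two choices of compatible metric fields differ by signs which do not depend on the hypersurface,
so linear independence does not depend on the choice. -/
theorem IsMetricFields.linearIndependent {u' : Fin n → E n → Fin n → ℝ}
    (hf : ∀ l, IsIsothermic k U (f l)) (hu : IsMetricFields U f u) (hu' : IsMetricFields U f u')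
    {x : E n} (hx : x ∈ U) (h : LinearIndependent ℝ (fun l => u' l x)) :
    LinearIndependent ℝ (fun l => u l x) := by
  rw [Fintype.linearIndependent_iff] at h ⊢
  intro c hc l
  refine h c ?_ l
  ext j
  have hcj := congrFun hc j
  simp only [Finset.sum_apply, Pi.smul_apply, smul_eq_mul, Pi.zero_apply] at hcj ⊢
  -- both fields are multiples of each other by a factor independent of the hypersurface
  have hfac : ∀ m, u' m x j = (u' l x j * (u l x j)⁻¹) * u m x j := by
    intro m
    have hne := hu.ne_zero hf m hx j
    have hne' := hu'.ne_zero hf m hx j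
    have hl := hu.ne_zero hf l hx j
    have hl' := hu'.ne_zero hf l hx j
    have h1 := hu.compatible l m x hx j
    have h2 := hu'.compatible l m x hx j
    have hp : pd j (f m) x ≠ 0 := ((hf m).immersed x hx).ne_zero j
    have h3 : (u l x j * (u m x j)⁻¹) • pd j (f m) x
        = (u' l x j * (u' m x j)⁻¹) • pd j (f m) x := by
      rw [mul_smul, ← h1, mul_smul, ← h2, smul_inv_smul₀ hl, smul_inv_smul₀ hl']
    have h4 := smul_left_injective ℝ hp h3
    field_simp at h4 ⊢
    linarith
  calc ∑ m, c m * u' m x j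
      = ∑ m, c m * (u' l x j * (u l x j)⁻¹ * u m x j) :=
        Finset.sum_congr rfl fun m _ => by rw [hfac m]
    _ = (u' l x j * (u l x j)⁻¹) * ∑ m, c m * u m x j := by
        rw [Finset.mul_sum]; exact Finset.sum_congr rfl fun m _ => by ring
    _ = 0 := by rw [hcj, mul_zero]

/-- The equations of the frame and of the metric fields. The components of `∂e_j/∂x_i` come from the
symmetry of the second derivatives of the hypersurface; a component with three different indices is
symmetric in two of them and antisymmetric in two others, hence zero. -/
theorem isFramedSequence_of_combescure
    (hf : IsCombescureSequence k U f) (hu : IsMetricFields U f u) (l₀ : Fin n)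
    {N : E n → E (n + 1)} (hN : IsUnitNormal U (f l₀) N) :
    IsFramedSequence k U f u (frame (f l₀) N (u l₀)) (assocF k (u l₀))
      (assocGamma k (f l₀) N (u l₀)) := by
  have hiso := hf.isothermic
  have hU : IsOpen U := (hiso l₀).isOpen
  have hne := fun l x (hx : x ∈ U) j => hu.ne_zero hiso l hx j
  have hus : ∀ l i, ContDiffOn ℝ ∞ (fun x => u l x i) U := fun l i =>
    contDiffOn_pi.1 (hu.smooth l) i
  set e := frame (f l₀) N (u l₀) with he
  set F := assocF k (u l₀) with hF
  set γ := assocGamma k (f l₀) N (u l₀) with hγ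
  have hes : ∀ a, ContDiffOn ℝ ∞ (e a) U := by
    rintro (i | _)
    · exact ((hus l₀ i).inv fun x hx => hne l₀ x hx i).smul (contDiffOn_pd hU (hiso l₀).smooth i)
    · exact hN.smooth
  have hpdf : ∀ x ∈ U, ∀ l j, pd j (f l) x = u l x j • e (Sum.inl j) x := by
    intro x hx l j
    change _ = u l x j • (u l₀ x j)⁻¹ • pd j (f l₀) x
    rw [← hu.compatible l l₀ x hx j, smul_inv_smul₀ (hne l x hx j)]
  have hort : ∀ x ∈ U, Orthonormal ℝ (fun a => e a x) := by
    intro x hx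
    have hei : ∀ i, e (Sum.inl i) x = (u l₀ x i)⁻¹ • pd i (f l₀) x := fun i => rfl
    refine ⟨?_, ?_⟩
    · rintro (i | _)
      · have h1 := hu.sq_eq l₀ x hx i
        rw [real_inner_self_eq_norm_sq] at h1
        change ‖e (Sum.inl i) x‖ = 1
        rw [hei, norm_smul, norm_inv, Real.norm_eq_abs, (sq_eq_sq_iff_abs_eq_abs _ _).1 h1,
          abs_norm, inv_mul_cancel₀]
        exact norm_ne_zero_iff.2 (((hiso l₀).immersed x hx).ne_zero i)
      · exact hN.unit x hx
    · rintro (i | _) (j | _) hij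
      · simp only [hei]
        rw [inner_smul_left, inner_smul_right, (hiso l₀).first_diag x hx i j (by simpa using hij),
          mul_zero, mul_zero]
      · simp only [hei]
        rw [inner_smul_left]
        exact mul_eq_zero_of_right _ (hN.normal x hx i)
      · simp only [hei]
        rw [inner_smul_right, real_inner_comm]
        exact mul_eq_zero_of_right _ (hN.normal x hx j)
      · exact absurd rfl hij
  have hFs : ∀ i j, ContDiffOn ℝ ∞ (fun x => F x i j) U := by
    intro i j
    simp only [hF, assocF, Matrix.of_apply]
    split_ifs
    · exact contDiffOn_const
    · exact (contDiffOn_const.mul (contDiffOn_pd hU (hus l₀ i) j)).div (hus l₀ j)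
        fun x hx => hne l₀ x hx j
  have hγs : ∀ i, ContDiffOn ℝ ∞ (fun x => γ x i) U := by
    intro i
    exact contDiffOn_const.mul (((contDiffOn_pd hU (contDiffOn_pd hU (hiso l₀).smooth i) i).inner ℝ
      hN.smooth).div (hus l₀ i) fun x hx => hne l₀ x hx i)
  have hF0 : ∀ x ∈ U, ∀ i, F x i i = 0 := fun x _ i => by simp [hF, assocF]
  have hed : ∀ a, ∀ x ∈ U, DifferentiableAt ℝ (e a) x := fun a x hx =>
    differentiableAt_of_contDiffOn hU (hes a) hx
  have hud : ∀ l i, ∀ x ∈ U, DifferentiableAt ℝ (fun y => u l y i) x := fun l i x hx =>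
    differentiableAt_of_contDiffOn hU (hus l i) hx
  have hinner : ∀ x ∈ U, ∀ a b, ⟪e a x, e b x⟫ = if a = b then (1 : ℝ) else 0 := fun x hx =>
    orthonormal_iff_ite.1 (hort x hx)
  -- `⟪e b, ∂e_a/∂x_i⟫` is antisymmetric in `a` and `b`.
  have hanti : ∀ x ∈ U, ∀ i a b, ⟪e b x, pd i (e a) x⟫ = -⟪e a x, pd i (e b) x⟫ := by
    intro x hx i a b
    have h1 := pd_inner i (hed a x hx) (hed b x hx)
    rw [pd_congr_of_eqOn hU (fun y hy => hinner y hy a b) hx i, pd_const] at h1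
    rw [real_inner_comm (e b x) (pd i (e a) x)] at h1
    linarith
  have hself : ∀ x ∈ U, ∀ i a, ⟪e a x, pd i (e a) x⟫ = 0 := by
    intro x hx i a
    have := hanti x hx i a a
    linarith
  have hsecond : ∀ x ∈ U, ∀ l i j, pd i (pd j (f l)) x
      = u l x j • pd i (e (Sum.inl j)) x + pd i (fun y => u l y j) x • e (Sum.inl j) x := by
    intro x hx l i j
    rw [pd_congr_of_eqOn hU (fun y hy => hpdf y hy l j) hx i]
    exact pd_smul i (hud l j x hx) (hed _ x hx)
  have hsymm : ∀ x ∈ U, ∀ l i j a,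
      u l x j * ⟪e a x, pd i (e (Sum.inl j)) x⟫
          + pd i (fun y => u l y j) x * ⟪e a x, e (Sum.inl j) x⟫
        = u l x i * ⟪e a x, pd j (e (Sum.inl i)) x⟫
          + pd j (fun y => u l y i) x * ⟪e a x, e (Sum.inl i) x⟫ := by
    intro x hx l i j a
    have h1 := congrArg (fun w => ⟪e a x, w⟫) (pd_comm hU (hiso l).smooth hx i j)
    simpa only [hsecond x hx, inner_add_right, inner_smul_right] using h1
  -- components along `e_i` itself
  have hij : ∀ x ∈ U, ∀ l i j, i ≠ j →
      u l x j * ⟪e (Sum.inl i) x, pd i (e (Sum.inl j)) x⟫ = pd j (fun y => u l y i) x := by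
    intro x hx l i j hne'
    have h1 := hsymm x hx l i j (Sum.inl i)
    rw [hself x hx, hinner x hx, hinner x hx, if_neg (by simpa using hne'), if_pos rfl] at h1
    linarith
  have hcomp : ∀ x ∈ U, ∀ i j, i ≠ j →
      ⟪e (Sum.inl i) x, pd i (e (Sum.inl j)) x⟫ = -(eps k i * F x i j) := by
    intro x hx i j hne'
    have h1 := hij x hx l₀ i j hne'
    have h2 : F x i j = -eps k i * pd j (fun y => u l₀ y i) x / u l₀ x j := by
      simp [hF, assocF, hne']
    rw [h2, ← h1]
    have h3 := hne l₀ x hx j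
    field_simp
    linear_combination (-⟪e (Sum.inl i) x, pd i (e (Sum.inl j)) x⟫) * eps_mul_self k i
  -- components with three different indices
  have hthree : ∀ x ∈ U, ∀ i j m, i ≠ j → i ≠ m → j ≠ m →
      ⟪e (Sum.inl m) x, pd i (e (Sum.inl j)) x⟫ = 0 := by
    intro x hx i j m h1 h2 h3
    have hs : ∀ a b c : Fin n, a ≠ c → b ≠ c →
        u l₀ x b * ⟪e (Sum.inl c) x, pd a (e (Sum.inl b)) x⟫
          = u l₀ x a * ⟪e (Sum.inl c) x, pd b (e (Sum.inl a)) x⟫ := by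
      intro a b c hac hbc
      have h := hsymm x hx l₀ a b (Sum.inl c)
      rw [hinner x hx, hinner x hx, if_neg (by simpa using hbc.symm),
        if_neg (by simpa using hac.symm)] at h
      linarith
    have e1 := hs i j m h2 h3
    have e2 := hs j m i h1.symm h2.symm
    have e3 := hs m i j h3.symm h1
    have a1 := hanti x hx i (Sum.inl m) (Sum.inl j)
    have a2 := hanti x hx j (Sum.inl m) (Sum.inl i)
    have a3 := hanti x hx m (Sum.inl i) (Sum.inl j)
    have hj := hne l₀ x hx j
    have hm := hne l₀ x hx m
    have hi := hne l₀ x hx i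
    rw [a2] at e2
    rw [a3, a1] at e3
    have h0 : u l₀ x j * u l₀ x m * (2 * ⟪e (Sum.inl m) x, pd i (e (Sum.inl j)) x⟫) = 0 := by
      linear_combination u l₀ x m * e1 - u l₀ x i * e2 + u l₀ x j * e3
    have := (mul_eq_zero.1 h0).resolve_left (mul_ne_zero hj hm)
    linarith
  have hnormal : ∀ x ∈ U, ∀ i j, ⟪e (Sum.inr ()) x, pd i (e (Sum.inl j)) x⟫
      = if j = i then eps k i * γ x i else 0 := by
    intro x hx i j
    have h1 : ⟪pd i (pd j (f l₀)) x, N x⟫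
        = u l₀ x j * ⟪e (Sum.inr ()) x, pd i (e (Sum.inl j)) x⟫ := by
      rw [real_inner_comm, hsecond x hx, inner_add_right, inner_smul_right, inner_smul_right]
      have := hinner x hx (Sum.inr ()) (Sum.inl j)
      rw [if_neg (by simp)] at this
      change _ + _ * ⟪e (Sum.inr ()) x, e (Sum.inl j) x⟫ = _
      rw [this, mul_zero, add_zero]
      rfl
    have hj := hne l₀ x hx j
    split_ifs with h
    · subst h
      have h2 : γ x j = eps k j * (⟪pd j (pd j (f l₀)) x, N x⟫ / u l₀ x j) := rfl
      rw [h2, h1, mul_div_cancel_left₀ _ hj]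
      linear_combination (-⟪e (Sum.inr ()) x, pd j (e (Sum.inl j)) x⟫) * eps_mul_self k j
    · rw [(hiso l₀).second_diag x hx (N x) (fun m => hN.normal x hx m) i j (Ne.symm h)] at h1
      exact (mul_eq_zero.1 h1.symm).resolve_left hj
  have hnull : ∀ x ∈ U, ∀ l, ∑ j, eps k j * u l x j ^ 2 = 0 := by
    intro x hx l
    rw [← (hiso l).guichard x hx]
    exact Finset.sum_congr rfl fun j _ => by rw [hu.sq_eq l x hx j]
  refine ⟨hU, hiso, hus, hes, hFs, hγs, hF0, hort, hpdf, ?_, ?_, hnull, ?_⟩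
  · intro x hx i a
    have hω : ∀ b, ⟪e b x, pd i (e a) x⟫ = omegaCoeff k (F x) (γ x) i b a := by
      intro b
      rcases a with q | _ <;> rcases b with p | _
      · rw [omegaCoeff_inl_inl]
        by_cases hpq : p = q
        · subst hpq
          rw [hself x hx]
          by_cases hp : p = i
          · simp [hp, hF0 x hx]
          · simp [hp]
        · by_cases hp : p = i
          · subst hp
            rw [hcomp x hx p q hpq, if_pos rfl, if_neg (Ne.symm hpq), add_zero]
          · by_cases hq : q = i
            · subst hq
              rw [hanti x hx, hcomp x hx q p (Ne.symm hpq), if_neg hp, if_pos rfl]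
              ring
            · rw [hthree x hx i q p (Ne.symm hq) (Ne.symm hp) (Ne.symm hpq), if_neg hp, if_neg hq]
              ring
      · rw [omegaCoeff_inr_inl]
        exact hnormal x hx i q
      · rw [omegaCoeff_inl_inr, hanti x hx]
        exact congrArg Neg.neg (hnormal x hx i p)
      · rw [omegaCoeff_inr_inr]
        exact hself x hx i _
    rw [(hort x hx).sum_inner_smul (pd i (e a) x)]
    simp only [hω]
  · intro x hx l j i
    have hoff : ∀ p, p ≠ j → pd j (fun y => u l y p) x = -(eps k p * F x p j * u l x j) := by
      intro p hp
      rw [← hij x hx l p j hp, hcomp x hx p j hp]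
      ring
    by_cases h : i = j
    · subst h
      -- the remaining derivative is obtained by differentiating `∑ ε_m u_m² = 0`
      have h1 : pd i (fun y => ∑ m, eps k m * (u l y m * u l y m)) x = 0 := by
        rw [pd_congr_of_eqOn hU (g' := fun _ => (0 : ℝ)) (fun y hy => ?_) hx i, pd_const]
        rw [← hnull y hy l]
        exact Finset.sum_congr rfl fun m _ => by ring
      rw [pd_sum i _ (g := fun m y => eps k m * (u l y m * u l y m)) fun m _ =>
        ((hud l m x hx).mul (hud l m x hx)).const_mul _] at h1
      have h2 : ∀ m, pd i (fun y => eps k m * (u l y m * u l y m)) x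
          = 2 * (eps k m * u l x m * pd i (fun y => u l y m) x) := by
        intro m
        rw [pd_const_mul i (eps k m) (g := fun y => u l y m * u l y m)
            ((hud l m x hx).mul (hud l m x hx)),
          pd_mul i (hud l m x hx) (hud l m x hx)]
        ring
      simp only [h2, ← Finset.mul_sum] at h1
      have h3 : ∑ m, eps k m * u l x m * pd i (fun y => u l y m) x = 0 := by linarith
      have h4 : ∀ m, eps k m * u l x m * pd i (fun y => u l y m) x
          = -(u l x i * (F x m i * u l x m))
            + if m = i then eps k i * u l x i * pd i (fun y => u l y i) x else 0 := by
        intro m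
        split_ifs with hm
        · subst hm; rw [hF0 x hx]; ring
        · rw [hoff m hm]
          linear_combination (-u l x m * F x m i * u l x i) * eps_mul_self k m
      rw [Finset.sum_congr rfl fun m _ => h4 m] at h3
      simp only [Finset.sum_add_distrib, Finset.sum_ite_eq', Finset.mem_univ, if_true,
        Finset.sum_neg_distrib, ← Finset.mul_sum] at h3
      have h5 : ∑ m, tauCoeff k (F x) i m i * u l x m = eps k i * ∑ m, F x m i * u l x m := by
        rw [Finset.mul_sum]
        refine Finset.sum_congr rfl fun m _ => ?_
        rw [tauCoeff_apply, if_pos rfl, hF0 x hx]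
        simp only [zero_mul, ite_self, sub_zero]
        ring
      rw [h5]
      have hi := hne l x hx i
      have h6 : u l x i * (eps k i * pd i (fun y => u l y i) x - ∑ m, F x m i * u l x m) = 0 := by
        linarith
      have h7 := (mul_eq_zero.1 h6).resolve_left hi
      linear_combination eps k i * h7 - pd i (fun y => u l y i) x * eps_mul_self k i
    · rw [hoff i h]
      simp only [tauCoeff_apply, if_neg h, zero_sub, neg_mul, ite_mul, zero_mul,
        Finset.sum_neg_distrib, Finset.sum_ite_eq', Finset.mem_univ, if_true]
      ring
  · intro x hx
    obtain ⟨u', hu', hind⟩ := hf.independent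
    exact hu.linearIndependent hiso hu' hx (hind x hx)

end Structure

/-! ### The Lax system of a Combescure sequence -/

section Lax

variable {n k : ℕ} {U : Set (E n)} {f : Fin n → E n → E (n + 1)} {u : Fin n → E n → Fin n → ℝ}
  {e : FrameIdx n → E n → E (n + 1)} {F : E n → Matrix (Fin n) (Fin n) ℝ} {γ : E n → Fin n → ℝ}

theorem IsFramedSequence.smooth_omega (h : IsFramedSequence k U f u e F γ) (i : Fin n)
    (a b : FrameIdx n) : ContDiffOn ℝ ∞ (fun x => omegaCoeff k (F x) (γ x) i a b) U := by
  rcases a with p | _ <;> rcases b with q | _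
  · simp only [omegaCoeff_inl_inl]
    have h1 := h.smooth_F i q
    have h2 := h.smooth_F i p
    split_ifs <;> fun_prop
  · simp only [omegaCoeff_inl_inr]
    have h1 := h.smooth_gamma i
    split_ifs <;> fun_prop
  · simp only [omegaCoeff_inr_inl]
    have h1 := h.smooth_gamma i
    split_ifs <;> fun_prop
  · exact contDiffOn_const

theorem IsFramedSequence.smooth_tau (h : IsFramedSequence k U f u e F γ) (i : Fin n)
    (p q : Fin n) : ContDiffOn ℝ ∞ (fun x => tauCoeff k (F x) i p q) U := by
  simp only [tauCoeff_apply]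
  have h1 := h.smooth_F p i
  have h2 := h.smooth_F q i
  split_ifs <;> fun_prop

/-- `ω` is flat because the orthonormal frame is parallel for it. -/
theorem IsFramedSequence.flat_omega (h : IsFramedSequence k U f u e F γ) {x : E n} (hx : x ∈ U)
    (i j : Fin n) (a b : FrameIdx n) :
    pd i (fun y => omegaCoeff k (F y) (γ y) j a b) x
      - pd j (fun y => omegaCoeff k (F y) (γ y) i a b) x
      + (omegaCoeff k (F x) (γ x) i * omegaCoeff k (F x) (γ x) j
        - omegaCoeff k (F x) (γ x) j * omegaCoeff k (F x) (γ x) i) a b = 0 :=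
  flat_of_parallel_family (W := fun i x => omegaCoeff k (F x) (γ x) i) h.isOpen h.smooth_e
    h.smooth_omega (fun x hx => (h.orthonormal x hx).linearIndependent) h.pd_e hx i j a b

/-- `τ` is flat because the `n` independent metric fields are parallel for it. -/
theorem IsFramedSequence.flat_tau (h : IsFramedSequence k U f u e F γ) {x : E n} (hx : x ∈ U)
    (i j : Fin n) (p q : Fin n) :
    pd i (fun y => tauCoeff k (F y) j p q) x - pd j (fun y => tauCoeff k (F y) i p q) x
      + (tauCoeff k (F x) i * tauCoeff k (F x) j
        - tauCoeff k (F x) j * tauCoeff k (F x) i) p q = 0 := by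
  have hsm : ∀ m, ContDiffOn ℝ ∞ (fun y => fun l => u l y m) U := fun m =>
    contDiffOn_pi.2 fun l => h.smooth_u l m
  refine flat_of_parallel_family (W := fun i x => tauCoeff k (F x) i)
    (g := fun m y => fun l => u l y m) h.isOpen hsm h.smooth_tau (fun x hx => ?_)
    (fun x hx i m => ?_) hx i j p q
  · have h1 := h.independent x hx
    exact Matrix.linearIndependent_cols_iff_isUnit.2
      (Matrix.linearIndependent_rows_iff_isUnit (A := Matrix.of fun l m => u l x m) |>.1 h1)
  · ext l
    rw [← pd_pi i (differentiableAt_of_contDiffOn h.isOpen (hsm m) hx) l, h.pd_u x hx l i m]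
    simp

/-- Flatness of `θ_s` reduces to flatness of `ω` and of `τ`, because the off-diagonal blocks are
constant and drop out of the commutators. -/
theorem IsFramedSequence.isSystemSolution (h : IsFramedSequence k U f u e F γ) :
    IsSystemSolution k U F γ := by
  refine ⟨h.smooth_F, h.smooth_gamma, h.diag_zero, fun s x hx i j a b => ?_⟩
  rw [laxCoeff_commutator]
  rcases a with a | a <;> rcases b with b | b
  · have h1 := h.flat_omega hx i j a b
    have hd := fun i => differentiableAt_of_contDiffOn h.isOpen (h.smooth_omega i a b) hx
    change pd i (fun y => ((omegaCoeff k (F y) (γ y) j a b : ℝ) : ℂ)) x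
      - pd j (fun y => ((omegaCoeff k (F y) (γ y) i a b : ℝ) : ℂ)) x + _ = 0
    rw [pd_ofReal i (hd j), pd_ofReal j (hd i), Matrix.fromBlocks_apply₁₁, Matrix.map_apply,
      Complex.ofRealHom_eq_coe]
    exact_mod_cast h1
  · change pd i (fun _ => -(s * ((upperBlock n k j a b : ℝ) : ℂ))) x
      - pd j (fun _ => -(s * ((upperBlock n k i a b : ℝ) : ℂ))) x + 0 = 0
    rw [pd_const, pd_const, sub_zero, add_zero]
  · change pd i (fun _ => s * ((lowerBlock n j a b : ℝ) : ℂ)) x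
      - pd j (fun _ => s * ((lowerBlock n i a b : ℝ) : ℂ)) x + 0 = 0
    rw [pd_const, pd_const, sub_zero, add_zero]
  · have h1 := h.flat_tau hx i j a b
    have hd := fun i => differentiableAt_of_contDiffOn h.isOpen (h.smooth_tau i a b) hx
    change pd i (fun y => ((tauCoeff k (F y) j a b : ℝ) : ℂ)) x
      - pd j (fun y => ((tauCoeff k (F y) i a b : ℝ) : ℂ)) x + _ = 0
    rw [pd_ofReal i (hd j), pd_ofReal j (hd i), Matrix.fromBlocks_apply₂₂, Matrix.map_apply,
      Complex.ofRealHom_eq_coe]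
    exact_mod_cast h1

theorem IsFramedSequence.smooth_lax (h : IsFramedSequence k U f u e F γ) (s : ℂ) (i : Fin n)
    (a b : BigIdx n) : ContDiffOn ℝ ∞ (fun x => laxCoeff k (F x) (γ x) s i a b) U := by
  rcases a with a | a <;> rcases b with b | b
  · exact Complex.ofRealCLM.contDiff.comp_contDiffOn (h.smooth_omega i a b)
  · exact contDiffOn_const
  · exact contDiffOn_const
  · exact Complex.ofRealCLM.contDiff.comp_contDiffOn (h.smooth_tau i a b)

/-- The real linear operator of multiplication by a complex matrix. -/
noncomputable def matrixOp (n : ℕ) :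
    (BigIdx n → BigIdx n → ℂ) →L[ℝ] ((BigIdx n → ℂ) →L[ℝ] (BigIdx n → ℂ)) :=
  LinearMap.toContinuousLinearMap
    { toFun := fun M => LinearMap.toContinuousLinearMap
        ((Matrix.mulVecLin (Matrix.of M)).restrictScalars ℝ)
      map_add' := fun M M' => by
        ext w : 1
        exact Matrix.add_mulVec (Matrix.of M) (Matrix.of M') w
      map_smul' := fun c M => by
        ext w : 1
        exact Matrix.smul_mulVec c (Matrix.of M) w }

theorem matrixOp_mul (M M' : Matrix (BigIdx n) (BigIdx n) ℂ) :
    matrixOp n (fun a b => M a b) * matrixOp n (fun a b => M' a b)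
      = matrixOp n (fun a b => (M * M') a b) := by
  ext w : 1
  exact Matrix.mulVec_mulVec w M M'

/-- Existence and uniqueness for the Lax system. -/
theorem IsFramedSequence.lax_existsUnique (h : IsFramedSequence k U f u e F γ)
    (hUsc : IsSimplyConnected U) (hU0 : (0 : E n) ∈ U) (s : ℂ) :
    (∀ v, ∃ y, IsLaxSolution k U F γ s v y) ∧
    ∀ v v' y y', IsLaxSolution k U F γ s v y → IsLaxSolution k U F γ s v' y' →
      ∀ q ∈ U, y q = y' q → EqOn y y' U := by
  set C : Fin n → E n → (BigIdx n → ℂ) →L[ℝ] (BigIdx n → ℂ) := fun i x =>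
    matrixOp n (fun a b => laxCoeff k (F x) (γ x) s i a b) with hC
  have hsm : ∀ i, ContDiffOn ℝ ∞
      (fun x => fun a b => laxCoeff k (F x) (γ x) s i a b) U := fun i =>
    contDiffOn_pi.2 fun a => contDiffOn_pi.2 fun b => h.smooth_lax s i a b
  have hCs : ∀ i, ContDiffOn ℝ ∞ (C i) U := fun i => (matrixOp n).contDiff.comp_contDiffOn (hsm i)
  have hpd : ∀ x ∈ U, ∀ i j, pd i (C j) x
      = matrixOp n (fun a b => pd i (fun y => laxCoeff k (F y) (γ y) s j a b) x) := by
    intro x hx i j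
    have hd := differentiableAt_of_contDiffOn h.isOpen (hsm j) hx
    rw [hC, pd_clm i (matrixOp n) hd]
    congr 1
    ext a b
    rw [← pd_pi i hd a, ← pd_pi i (differentiableAt_pi.1 hd a) b]
  have hflat : ∀ x ∈ U, ∀ i j,
      pd i (C j) x - pd j (C i) x + (C i x * C j x - C j x * C i x) = 0 := by
    intro x hx i j
    rw [hpd x hx, hpd x hx, hC]
    simp only
    rw [matrixOp_mul, matrixOp_mul, ← map_sub, ← map_sub, ← map_add]
    refine (congrArg (matrixOp n) ?_).trans (map_zero (matrixOp n))
    ext a b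
    exact h.isSystemSolution.flat s x hx i j a b
  have hmain := linearSystem_existsUnique h.isOpen hUsc hCs hflat hU0
  have hsol : ∀ v y, IsLaxSolution k U F γ s v y → ∀ x ∈ U, DifferentiableAt ℝ y x ∧
      ∀ i, pd i y x = -(C i x (y x)) := fun v y hy x hx =>
    ⟨hy.differentiable x hx, fun i => hy.deriv_eq x hx i⟩
  refine ⟨fun v => ?_, fun v v' y y' hy hy' => hmain.2 y y' (hsol v y hy) (hsol v' y' hy')⟩
  obtain ⟨y, hy0, hy⟩ := hmain.1 v
  exact ⟨y, fun x hx => (hy x hx).1, fun x hx i => (hy x hx).2 i, hy0⟩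

/-! ### Conserved quantities of the Lax system -/

theorem laxCoeff_mulVec_inl (F : Matrix (Fin n) (Fin n) ℝ) (γ : Fin n → ℝ) (s : ℂ) (i : Fin n)
    (w : BigIdx n → ℂ) (a : FrameIdx n) : (laxCoeff k F γ s i).mulVec w (Sum.inl a)
      = ∑ b, (omegaCoeff k F γ i a b : ℂ) * w (Sum.inl b)
        - s * ∑ q, (upperBlock n k i a q : ℂ) * w (Sum.inr q) := by
  rw [Matrix.mulVec, dotProduct, Fintype.sum_sum_type, Finset.mul_sum, sub_eq_add_neg,
    ← Finset.sum_neg_distrib]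
  congr 1
  refine Finset.sum_congr rfl fun q _ => ?_
  change -(s * (upperBlock n k i a q : ℂ)) * w (Sum.inr q) = _
  ring

theorem laxCoeff_mulVec_inr (F : Matrix (Fin n) (Fin n) ℝ) (γ : Fin n → ℝ) (s : ℂ) (i : Fin n)
    (w : BigIdx n → ℂ) (p : Fin n) : (laxCoeff k F γ s i).mulVec w (Sum.inr p)
      = s * ∑ b, (lowerBlock n i p b : ℂ) * w (Sum.inl b)
        + ∑ q, (tauCoeff k F i p q : ℂ) * w (Sum.inr q) := by
  rw [Matrix.mulVec, dotProduct, Fintype.sum_sum_type, Finset.mul_sum]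
  congr 1
  refine Finset.sum_congr rfl fun q _ => ?_
  change (s * (lowerBlock n i p q : ℂ)) * w (Sum.inl q) = _
  ring

theorem sum_upperBlock_mul (i : Fin n) (a : FrameIdx n) (w : Fin n → ℂ) :
    ∑ q, (upperBlock n k i a q : ℂ) * w q = if a = Sum.inl i then (eps k i : ℂ) * w i else 0 := by
  rcases a with p | _
  · by_cases hp : p = i <;> simp [upperBlock_inl, hp, apply_ite]
  · simp [upperBlock_inr]

theorem sum_lowerBlock_mul (i p : Fin n) (w : FrameIdx n → ℂ) :
    ∑ b, (lowerBlock n i p b : ℂ) * w b = if p = i then w (Sum.inl i) else 0 := by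
  rw [Fintype.sum_sum_type]
  by_cases hp : p = i <;> simp [lowerBlock_inl, lowerBlock_inr, hp, apply_ite]

theorem sum_sum_eq_zero_of_antisymm {ι : Type*} [Fintype ι] (M : ι → ι → ℂ)
    (h : ∀ a b, M a b = -M b a) : ∑ a, ∑ b, M a b = 0 := by
  have h1 : ∑ a, ∑ b, M a b = -∑ a, ∑ b, M a b := by
    conv_lhs => rw [Finset.sum_comm]
    rw [← Finset.sum_neg_distrib]
    refine Finset.sum_congr rfl fun b _ => ?_
    rw [← Finset.sum_neg_distrib]
    exact Finset.sum_congr rfl fun a _ => h _ _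
  exact self_eq_neg.1 h1

/-- The Lax pair takes values in the orthogonal Lie algebra of the bilinear form. -/
theorem bigForm_laxCoeff_mulVec (F : Matrix (Fin n) (Fin n) ℝ) (γ : Fin n → ℝ) (s : ℂ)
    (i : Fin n) (w : BigIdx n → ℂ) : bigForm k w ((laxCoeff k F γ s i).mulVec w) = 0 := by
  have h1 : ∑ a, ∑ b, w (Sum.inl a) * ((omegaCoeff k F γ i a b : ℂ) * w (Sum.inl b)) = 0 :=
    sum_sum_eq_zero_of_antisymm _ fun a b => by
      rw [omegaCoeff_antisymm]; push_cast; ring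
  have h2 : ∑ p, ∑ q, (eps k p : ℂ) * w (Sum.inr p) * ((tauCoeff k F i p q : ℂ) * w (Sum.inr q))
      = 0 := sum_sum_eq_zero_of_antisymm _ fun p q => by
    have h := congrArg (fun r : ℝ => (r : ℂ)) (tauCoeff_eps_antisymm k F i p q)
    push_cast at h
    linear_combination w (Sum.inr p) * w (Sum.inr q) * h
  simp only [← Finset.mul_sum] at h1 h2
  simp only [bigForm, laxCoeff_mulVec_inl, laxCoeff_mulVec_inr, mul_add, mul_sub,
    Finset.sum_add_distrib, Finset.sum_sub_distrib, h1, h2]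
  rw [Fintype.sum_sum_type]
  simp only [sum_upperBlock_mul, sum_lowerBlock_mul]
  simp
  ring

theorem IsLaxSolution.bigForm_eq (hU : IsOpen U) (hUc : IsPreconnected U) (hU0 : (0 : E n) ∈ U)
    {s : ℂ} {v : BigIdx n → ℂ} {y : E n → BigIdx n → ℂ} (hy : IsLaxSolution k U F γ s v y)
    {x : E n} (hx : x ∈ U) : bigForm k (y x) (y x) = bigForm k v v := by
  have hd : ∀ a, ∀ z ∈ U, DifferentiableAt ℝ (fun x => y x a) z := fun a z hz =>
    differentiableAt_pi.1 (hy.differentiable z hz) a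
  have hfd : ∀ z ∈ U, DifferentiableAt ℝ (fun x => bigForm k (y x) (y x)) z := by
    intro z hz
    have := fun a => hd a z hz
    unfold bigForm
    fun_prop
  have hpd : ∀ z ∈ U, ∀ i, pd i (fun x => bigForm k (y x) (y x)) z = 0 := by
    intro z hz i
    have h0 := fun a => hd a z hz
    have h1 : pd i (fun x => bigForm k (y x) (y x)) z = 2 * bigForm k (y z) (pd i y z) := by
      unfold bigForm
      rw [pd_add i (by fun_prop) (by fun_prop),
        pd_sum i _ (g := fun a x => y x (Sum.inl a) * y x (Sum.inl a)) (fun a _ => by fun_prop),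
        pd_sum i _ (g := fun p x => (eps k p : ℂ) * y x (Sum.inr p) * y x (Sum.inr p))
          (fun a _ => by fun_prop), mul_add, Finset.mul_sum, Finset.mul_sum]
      congr 1
      · refine Finset.sum_congr rfl fun a _ => ?_
        rw [pd_mul i (h0 _) (h0 _), pd_pi i (hy.differentiable z hz)]
        ring
      · refine Finset.sum_congr rfl fun p _ => ?_
        rw [pd_mul i (c := fun x => (eps k p : ℂ) * y x (Sum.inr p)) (by fun_prop) (h0 _),
          pd_const_mul i _ (h0 _), pd_pi i (hy.differentiable z hz)]
        ring
    have h2 : bigForm k (y z) (-((laxCoeff k (F z) (γ z) s i).mulVec (y z)))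
        = -bigForm k (y z) ((laxCoeff k (F z) (γ z) s i).mulVec (y z)) := by
      simp [bigForm, Finset.sum_neg_distrib, add_comm]
    rw [h1, hy.deriv_eq z hz i, h2, bigForm_laxCoeff_mulVec, neg_zero, mul_zero]
  have h := eqOn_const_of_pd_eq_zero hU hUc hfd hpd hx hU0
  rw [h, hy.initial]

/-- The real structure `(A, B) ↦ (Ā, c B̄)`. -/
noncomputable def realStructure (n : ℕ) (c : ℝ) : (BigIdx n → ℂ) →L[ℝ] (BigIdx n → ℂ) :=
  ContinuousLinearMap.pi fun a => Sum.elim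
    (fun b => Complex.conjCLE.toContinuousLinearMap.comp (ContinuousLinearMap.proj (Sum.inl b)))
    (fun p => c • Complex.conjCLE.toContinuousLinearMap.comp
      (ContinuousLinearMap.proj (Sum.inr p))) a

theorem realStructure_inl (c : ℝ) (w : BigIdx n → ℂ) (a : FrameIdx n) :
    realStructure n c w (Sum.inl a) = (starRingEnd ℂ) (w (Sum.inl a)) := rfl

theorem realStructure_inr (c : ℝ) (w : BigIdx n → ℂ) (p : Fin n) :
    realStructure n c w (Sum.inr p) = c * (starRingEnd ℂ) (w (Sum.inr p)) := rfl

/-- If `ᾱ = c α` with `c = ±1`, the Lax pair at `α` commutes with the real structure of sign `c`. -/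
theorem realStructure_laxCoeff_mulVec (F : Matrix (Fin n) (Fin n) ℝ) (γ : Fin n → ℝ) {α : ℂ}
    {c : ℝ} (hα : (starRingEnd ℂ) α = c * α) (hc : c * c = 1) (i : Fin n) (w : BigIdx n → ℂ) :
    realStructure n c ((laxCoeff k F γ α i).mulVec w)
      = (laxCoeff k F γ α i).mulVec (realStructure n c w) := by
  have hc' : (c : ℂ) * c = 1 := by exact_mod_cast hc
  ext (a | p)
  · rw [realStructure_inl, laxCoeff_mulVec_inl, laxCoeff_mulVec_inl]
    simp only [map_sub, map_sum, map_mul, Complex.conj_ofReal, hα, realStructure_inl,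
      realStructure_inr, sum_upperBlock_mul]
    split_ifs <;> simp
    ring
  · rw [realStructure_inr, laxCoeff_mulVec_inr, laxCoeff_mulVec_inr]
    simp only [map_add, map_sum, map_mul, Complex.conj_ofReal, hα, realStructure_inl,
      realStructure_inr, mul_add, Finset.mul_sum]
    congr 1
    · refine Finset.sum_congr rfl fun b _ => ?_
      linear_combination (α * (lowerBlock n i p b * (starRingEnd ℂ) (w (Sum.inl b)))) * hc'
    · refine Finset.sum_congr rfl fun b _ => ?_
      ring

/-- The generator stays isotropic because the form is a first integral, and it stays non-zero and
real because solutions are unique: the real structure maps solutions to solutions. -/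
theorem IsFramedSequence.isRealIsotropic (h : IsFramedSequence k U f u e F γ)
    (hUsc : IsSimplyConnected U) (hU0 : (0 : E n) ∈ U) {α : ℂ} {v : BigIdx n → ℂ}
    (hv : IsRealIsotropic k α v) {y : E n → BigIdx n → ℂ} (hy : IsLaxSolution k U F γ α v y)
    {x : E n} (hx : x ∈ U) : IsRealIsotropic k α (y x) := by
  have huniq := (h.lax_existsUnique hUsc hU0 α).2
  have hreal : ∀ c : ℝ, (starRingEnd ℂ) α = c * α → c * c = 1 → realStructure n c v = v →
      realStructure n c (y x) = y x := by
    intro c hc hcc hcv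
    have hsol : IsLaxSolution k U F γ α v (fun z => realStructure n c (y z)) := by
      refine ⟨fun z hz => (realStructure n c).differentiableAt.comp z (hy.differentiable z hz),
        fun z hz i => ?_, by rw [hy.initial, hcv]⟩
      rw [pd_clm i _ (hy.differentiable z hz), hy.deriv_eq z hz i, map_neg,
        realStructure_laxCoeff_mulVec _ _ hc hcc]
    exact huniq v v _ _ hsol hy 0 hU0 (by simp only [hy.initial, hcv]) hx
  have hne : y x ≠ 0 := by
    intro h0
    have hz : IsLaxSolution k U F γ α 0 (fun _ => 0) :=
      ⟨fun z _ => differentiableAt_const _, fun z _ i => by rw [pd_const]; simp, rfl⟩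
    refine hv.ne_zero ?_
    rw [← hy.initial]
    exact huniq v 0 _ _ hy hz x hx h0 hU0
  have hiso : bigForm k (y x) (y x) = 0 := by
    rw [hy.bigForm_eq h.isOpen hUsc.isPathConnected.isConnected.isPreconnected hU0 hx,
      hv.isotropic]
  have hupper : ∀ c, realStructure n c (y x) = y x → ∀ a, (y x (Sum.inl a)).im = 0 :=
    fun c hc a => Complex.conj_eq_iff_im.1 (congrFun hc (Sum.inl a))
  have hvup : ∀ a, (starRingEnd ℂ) (v (Sum.inl a)) = v (Sum.inl a) := fun a =>
    Complex.conj_eq_iff_im.2 (hv.real_upper a)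
  rcases hv.reality with ⟨hα, hB⟩ | ⟨hα, hB⟩
  · have h1 := hreal 1 (by simp [Complex.conj_eq_iff_im.2 hα]) (by norm_num) (by
      ext (a | p)
      · exact hvup a
      · rw [realStructure_inr, Complex.conj_eq_iff_im.2 (hB p)]; simp)
    refine ⟨hne, hiso, hv.param_ne_zero, hupper 1 h1, Or.inl ⟨hα, fun p => ?_⟩⟩
    have h2 := congrFun h1 (Sum.inr p)
    rw [realStructure_inr] at h2
    exact Complex.conj_eq_iff_im.1 (by simpa using h2)
  · have him : ∀ z : ℂ, z.re = 0 → (starRingEnd ℂ) z = -z := fun z hz =>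
      Complex.ext (by simp [hz]) (by simp)
    have h1 := hreal (-1) (by simp [him α hα]) (by norm_num) (by
      ext (a | p)
      · exact hvup a
      · rw [realStructure_inr, him _ (hB p)]; simp)
    refine ⟨hne, hiso, hv.param_ne_zero, hupper (-1) h1, Or.inr ⟨hα, fun p => ?_⟩⟩
    have h2 := congrArg Complex.re (congrFun h1 (Sum.inr p))
    rw [realStructure_inr] at h2
    simp at h2
    linarith

/-! ### Lines moved by the involution -/

theorem rho_inl (w : BigIdx n → ℂ) (a : FrameIdx n) : rho n w (Sum.inl a) = w (Sum.inl a) := by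
  simp [rho, Matrix.mulVec_diagonal]

theorem rho_inr (w : BigIdx n → ℂ) (p : Fin n) : rho n w (Sum.inr p) = -w (Sum.inr p) := by
  simp [rho, Matrix.mulVec_diagonal]

theorem lineMoved_iff (w : BigIdx n → ℂ) :
    LineMoved w ↔ (∃ a, w (Sum.inl a) ≠ 0) ∧ ∃ p, w (Sum.inr p) ≠ 0 := by
  rw [LineMoved, Submodule.map_span, Set.image_singleton, Ne,
    Submodule.span_singleton_eq_span_singleton]
  constructor
  · intro h
    constructor
    · by_contra! h0
      refine h ⟨-1, ?_⟩
      ext (a | p)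
      · simp [rho_inl, h0]
      · simp [Units.smul_def, rho_inr]
    · by_contra! h0
      refine h ⟨1, ?_⟩
      ext (a | p)
      · simp [rho_inl]
      · simp [rho_inr, h0]
  · rintro ⟨⟨a, ha⟩, p, hp⟩ ⟨z, hz⟩
    have h1 := congrFun hz (Sum.inl a)
    have h2 := congrFun hz (Sum.inr p)
    rw [Units.smul_def, Pi.smul_apply, smul_eq_mul, rho_inl] at h1
    rw [Units.smul_def, Pi.smul_apply, smul_eq_mul, rho_inr] at h2
    have h3 : (z : ℂ) = 1 := mul_right_cancel₀ ha (by rw [h1, one_mul])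
    rw [h3, one_mul] at h2
    exact hp (neg_eq_self.1 h2)

end Lax

/-! ### The Lax system in real form -/

section RealForm

variable {n k : ℕ} {U : Set (E n)} {f : Fin n → E n → E (n + 1)} {u : Fin n → E n → Fin n → ℝ}
  {e : FrameIdx n → E n → E (n + 1)} {F : E n → Matrix (Fin n) (Fin n) ℝ} {γ : E n → Fin n → ℝ}

/-- A solution of a linear system with smooth coefficients is smooth. -/
theorem contDiffOn_of_pd_eq {V : Type*} [NormedAddCommGroup V] [NormedSpace ℝ V] (hU : IsOpen U)
    {y : E n → V} (hy : ∀ x ∈ U, DifferentiableAt ℝ y x) {G : Fin n → E n → V}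
    (hpd : ∀ x ∈ U, ∀ i, pd i y x = G i x)
    (hG : ∀ m : ℕ, ContDiffOn ℝ m y U → ∀ i, ContDiffOn ℝ m (G i) U) : ContDiffOn ℝ ∞ y U := by
  have key : ∀ m : ℕ, ContDiffOn ℝ m y U := by
    intro m
    induction m with
    | zero =>
      exact contDiffOn_zero.2 fun x hx => (hy x hx).continuousAt.continuousWithinAt
    | succ m ih =>
      push_cast
      refine (contDiffOn_succ_iff_fderiv_of_isOpen hU).2
        ⟨fun x hx => (hy x hx).differentiableWithinAt, by simp, ?_⟩
      have h1 : ContDiffOn ℝ m (fun x => ∑ i,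
          (EuclideanSpace.proj i : E n →L[ℝ] ℝ).smulRight (G i x)) U :=
        ContDiffOn.sum fun i _ => (ContinuousLinearMap.smulRightL ℝ (E n) V
          (EuclideanSpace.proj i : E n →L[ℝ] ℝ)).contDiff.comp_contDiffOn (hG m ih i)
      refine h1.congr fun x hx => ?_
      ext h
      simp [fderiv_eq_sum_pd, hpd x hx]
  exact contDiffOn_infty.2 key

theorem IsFramedSequence.smooth_laxSolution (h : IsFramedSequence k U f u e F γ) {s : ℂ}
    {v : BigIdx n → ℂ} {y : E n → BigIdx n → ℂ} (hy : IsLaxSolution k U F γ s v y) :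
    ContDiffOn ℝ ∞ y U := by
  refine contDiffOn_of_pd_eq h.isOpen hy.differentiable hy.deriv_eq fun m hm i => ?_
  refine ContDiffOn.neg (contDiffOn_pi.2 fun a => ?_)
  have h1 : ∀ b, ContDiffOn ℝ m (fun x => laxCoeff k (F x) (γ x) s i a b) U := fun b =>
    (h.smooth_lax s i a b).of_le (by exact_mod_cast le_top)
  have h2 := fun b => contDiffOn_pi.1 hm b
  simp only [Matrix.mulVec, dotProduct]
  exact ContDiffOn.sum fun b _ => (h1 b).mul (h2 b)

/-- The real form of the Lax system: `A` is the upper part of the solution, `b` its lower part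
divided by `α`, and `m = α²`, which is a real number. -/
structure IsRealLaxSolution (k : ℕ) (U : Set (E n)) (F : E n → Matrix (Fin n) (Fin n) ℝ)
    (γ : E n → Fin n → ℝ) (m : ℝ) (A : E n → FrameIdx n → ℝ) (b : E n → Fin n → ℝ) : Prop where
  smooth_A : ∀ a, ContDiffOn ℝ ∞ (fun x => A x a) U
  smooth_b : ∀ p, ContDiffOn ℝ ∞ (fun x => b x p) U
  pd_A : ∀ x ∈ U, ∀ i a, pd i (fun y => A y a) x
    = -∑ c, omegaCoeff k (F x) (γ x) i a c * A x c
      + if a = Sum.inl i then m * (eps k i * b x i) else 0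
  pd_b : ∀ x ∈ U, ∀ i p, pd i (fun y => b y p) x
    = -(if p = i then A x (Sum.inl i) else 0) - ∑ q, tauCoeff k (F x) i p q * b x q
  null : ∀ x ∈ U, ∑ a, A x a ^ 2 + m * ∑ p, eps k p * b x p ^ 2 = 0

theorem sq_eq_ofReal {α : ℂ} (hα : α.im = 0 ∨ α.re = 0) : α ^ 2 = (((α ^ 2).re : ℝ) : ℂ) := by
  apply Complex.ext
  · simp
  · rcases hα with h | h <;> simp [pow_two, h]

theorem IsRealIsotropic.upper_eq {α : ℂ} {w : BigIdx n → ℂ} (hw : IsRealIsotropic k α w)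
    (a : FrameIdx n) : w (Sum.inl a) = ((w (Sum.inl a)).re : ℂ) :=
  Complex.ext (by simp) (by simp [hw.real_upper a])

theorem IsRealIsotropic.lower_eq {α : ℂ} {w : BigIdx n → ℂ} (hw : IsRealIsotropic k α w)
    (p : Fin n) : w (Sum.inr p) = α * (((w (Sum.inr p) / α).re : ℝ) : ℂ) := by
  have him : (w (Sum.inr p) / α).im = 0 := by
    rcases hw.reality with ⟨h1, h2⟩ | ⟨h1, h2⟩ <;> simp [Complex.div_im, h1, h2 p]
  have h : (((w (Sum.inr p) / α).re : ℝ) : ℂ) = w (Sum.inr p) / α :=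
    Complex.ext (by simp) (by simp [him])
  rw [h, mul_div_cancel₀ _ hw.param_ne_zero]

theorem IsFramedSequence.isRealLaxSolution (h : IsFramedSequence k U f u e F γ) {α : ℂ}
    {v : BigIdx n → ℂ} {y : E n → BigIdx n → ℂ} (hy : IsLaxSolution k U F γ α v y)
    (hre : ∀ x ∈ U, IsRealIsotropic k α (y x)) :
    IsRealLaxSolution k U F γ (α ^ 2).re (fun x a => (y x (Sum.inl a)).re)
      (fun x p => (y x (Sum.inr p) / α).re) := by
  have hys := h.smooth_laxSolution hy
  have hya := fun a => contDiffOn_pi.1 hys a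
  have hsa : ∀ a, ContDiffOn ℝ ∞ (fun x => (y x (Sum.inl a)).re) U := fun a =>
    Complex.reCLM.contDiff.comp_contDiffOn (hya (Sum.inl a))
  have hsb : ∀ p, ContDiffOn ℝ ∞ (fun x => (y x (Sum.inr p) / α).re) U := fun p =>
    Complex.reCLM.contDiff.comp_contDiffOn ((hya (Sum.inr p)).div_const α)
  have hda : ∀ a, ∀ x ∈ U, DifferentiableAt ℝ (fun z => y z a) x := fun a x hx =>
    differentiableAt_pi.1 (hy.differentiable x hx) a
  have hpd : ∀ x ∈ U, ∀ i a, pd i (fun z => y z a) x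
      = -((laxCoeff k (F x) (γ x) α i).mulVec (y x) a) := by
    intro x hx i a
    rw [pd_pi i (hy.differentiable x hx), hy.deriv_eq x hx i]
    rfl
  refine ⟨hsa, hsb, fun x hx i a => ?_, fun x hx i p => ?_, fun x hx => ?_⟩
  · have hα : α ^ 2 = (((α ^ 2).re : ℝ) : ℂ) :=
      sq_eq_ofReal ((hre x hx).reality.imp And.left And.left)
    have h1 : ((pd i (fun z => (y z (Sum.inl a)).re) x : ℝ) : ℂ)
        = pd i (fun z => y z (Sum.inl a)) x := by
      rw [← pd_ofReal i (differentiableAt_of_contDiffOn h.isOpen (hsa a) hx)]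
      exact pd_congr_of_eqOn h.isOpen (fun z hz => ((hre z hz).upper_eq a).symm) hx i
    rw [hpd x hx, laxCoeff_mulVec_inl, sum_upperBlock_mul] at h1
    apply Complex.ofReal_injective
    rw [h1]
    have h2 : ∑ c, (omegaCoeff k (F x) (γ x) i a c : ℂ) * y x (Sum.inl c)
        = ∑ c, (omegaCoeff k (F x) (γ x) i a c : ℂ) * ((y x (Sum.inl c)).re : ℂ) :=
      Finset.sum_congr rfl fun c _ => congrArg _ ((hre x hx).upper_eq c)
    rw [h2, (hre x hx).lower_eq i, mul_div_cancel_left₀ _ (hre x hx).param_ne_zero,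
      Complex.ofReal_re]
    split_ifs
    · push_cast
      linear_combination (eps k i : ℂ) * (((y x (Sum.inr i) / α).re : ℝ) : ℂ) * hα
    · push_cast
      ring
  · have hα0 := (hre x hx).param_ne_zero
    have h1 : ((pd i (fun z => (y z (Sum.inr p) / α).re) x : ℝ) : ℂ)
        = α⁻¹ * pd i (fun z => y z (Sum.inr p)) x := by
      rw [← pd_ofReal i (differentiableAt_of_contDiffOn h.isOpen (hsb p) hx),
        ← pd_const_mul i α⁻¹ (hda _ x hx)]
      refine pd_congr_of_eqOn h.isOpen (fun z hz => ?_) hx i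
      rw [(hre z hz).lower_eq p, mul_div_cancel_left₀ _ hα0, Complex.ofReal_re,
        inv_mul_cancel_left₀ hα0]
    rw [hpd x hx, laxCoeff_mulVec_inr, sum_lowerBlock_mul] at h1
    apply Complex.ofReal_injective
    rw [h1]
    have h2 : ∑ q, (tauCoeff k (F x) i p q : ℂ) * y x (Sum.inr q)
        = α * ∑ q, (tauCoeff k (F x) i p q : ℂ) * (((y x (Sum.inr q) / α).re : ℝ) : ℂ) := by
      rw [Finset.mul_sum]
      refine Finset.sum_congr rfl fun q _ => ?_
      conv_lhs => rw [(hre x hx).lower_eq q]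
      ring
    have h3 : α * y x (Sum.inl (Sum.inl i)) = α * ((y x (Sum.inl (Sum.inl i))).re : ℂ) :=
      congrArg _ ((hre x hx).upper_eq (Sum.inl i))
    rw [h2]
    split_ifs
    · rw [h3, ← mul_add, ← mul_neg, inv_mul_cancel_left₀ hα0]
      push_cast
      ring
    · rw [← mul_add, ← mul_neg, inv_mul_cancel_left₀ hα0]
      push_cast
      ring
  · have hα : α ^ 2 = (((α ^ 2).re : ℝ) : ℂ) :=
      sq_eq_ofReal ((hre x hx).reality.imp And.left And.left)
    have h1 := (hre x hx).isotropic
    rw [bigForm] at h1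
    apply Complex.ofReal_injective
    push_cast
    rw [← hα, ← h1, Finset.mul_sum]
    congr 1
    · refine Finset.sum_congr rfl fun a _ => ?_
      conv_rhs => rw [(hre x hx).upper_eq a]
      ring
    · refine Finset.sum_congr rfl fun p _ => ?_
      conv_rhs => rw [(hre x hx).lower_eq p]
      ring

end RealForm

/-! ### The transformed frame -/

section Transform

variable {n k : ℕ} {U : Set (E n)} {f : Fin n → E n → E (n + 1)} {u : Fin n → E n → Fin n → ℝ}
  {e : FrameIdx n → E n → E (n + 1)} {F : E n → Matrix (Fin n) (Fin n) ℝ} {γ : E n → Fin n → ℝ}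

/-- The vector `∑ A_a e_a` along which the hypersurfaces are moved. -/
noncomputable def moveVec (e : FrameIdx n → E n → E (n + 1)) (A : E n → FrameIdx n → ℝ) (x : E n) :
    E (n + 1) := ∑ a, A x a • e a x

/-- The factor `2 / |A|²`. -/
noncomputable def reflFactor (A : E n → FrameIdx n → ℝ) (x : E n) : ℝ := 2 / ∑ a, A x a ^ 2

/-- The pairing `bᵀ u`. -/
def pairing (b : E n → Fin n → ℝ) (u : E n → Fin n → ℝ) (x : E n) : ℝ := ∑ p, b x p * u x p

/-- The frame reflected in the hyperplane orthogonal to `∑ A_a e_a`. -/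
noncomputable def newFrame (e : FrameIdx n → E n → E (n + 1)) (A : E n → FrameIdx n → ℝ)
    (a : FrameIdx n) (x : E n) : E (n + 1) :=
  e a x - (reflFactor A x * A x a) • moveVec e A x

/-- The metric fields `u + s m (bᵀ u) J b` of the transformed hypersurface, where `s = 2 / |A|²`. -/
noncomputable def newMetric (k : ℕ) (m : ℝ) (A : E n → FrameIdx n → ℝ) (b u : E n → Fin n → ℝ)
    (x : E n) (j : Fin n) : ℝ :=
  u x j + reflFactor A x * m * pairing b u x * (eps k j * b x j)

/-- The transformed hypersurface, written without the normalization of the generator. -/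
noncomputable def newSurface (f : E n → E (n + 1)) (e : FrameIdx n → E n → E (n + 1))
    (A : E n → FrameIdx n → ℝ) (b u : E n → Fin n → ℝ) (x : E n) : E (n + 1) :=
  f x + (reflFactor A x * pairing b u x) • moveVec e A x

theorem differentiableAt_reflFactor {A : E n → FrameIdx n → ℝ} {x : E n}
    (hrd : DifferentiableAt ℝ (fun y => ∑ a, A y a ^ 2) x) (hA : ∑ a, A x a ^ 2 ≠ 0) :
    DifferentiableAt ℝ (reflFactor A) x := by
  have h1 : reflFactor A = fun y => 2 * (∑ a, A y a ^ 2)⁻¹ := rfl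
  rw [h1]
  exact (hrd.fun_inv hA).const_mul 2

variable {m : ℝ} {A : E n → FrameIdx n → ℝ} {b : E n → Fin n → ℝ}

theorem inner_moveVec {x : E n} (hort : Orthonormal ℝ (fun a => e a x)) (a : FrameIdx n) :
    ⟪e a x, moveVec e A x⟫ = A x a := by
  rw [moveVec]
  exact hort.inner_right_fintype (A x) a

theorem inner_moveVec_self {x : E n} (hort : Orthonormal ℝ (fun a => e a x)) :
    ⟪moveVec e A x, moveVec e A x⟫ = ∑ a, A x a ^ 2 := by
  conv_lhs => rw [moveVec, sum_inner]
  refine Finset.sum_congr rfl fun a _ => ?_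
  rw [inner_smul_left, ← moveVec, inner_moveVec hort]
  simp [pow_two]

theorem orthonormal_newFrame {x : E n} (hort : Orthonormal ℝ (fun a => e a x))
    (hA : ∑ a, A x a ^ 2 ≠ 0) : Orthonormal ℝ (fun a => newFrame e A a x) := by
  rw [orthonormal_iff_ite]
  intro a c
  have h1 := orthonormal_iff_ite.1 hort a c
  rw [← h1]
  simp only [newFrame, inner_sub_left, inner_sub_right, inner_smul_left, inner_smul_right,
    inner_moveVec hort, inner_moveVec_self hort, real_inner_comm _ (moveVec e A x)]
  simp only [reflFactor, RCLike.conj_to_real]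
  field_simp
  ring

/-- The terms with `ω` in the derivatives of `A` and of `e` cancel, so only the contribution of the
off-diagonal block of the Lax pair is left. -/
theorem IsFramedSequence.pd_moveVec (h : IsFramedSequence k U f u e F γ)
    (hr : IsRealLaxSolution k U F γ m A b) {x : E n} (hx : x ∈ U) (i : Fin n) :
    pd i (moveVec e A) x = (m * (eps k i * b x i)) • e (Sum.inl i) x := by
  have hAd := fun a => differentiableAt_of_contDiffOn h.isOpen (hr.smooth_A a) hx
  have hed := fun a => differentiableAt_of_contDiffOn h.isOpen (h.smooth_e a) hx
  have h0 : pd i (moveVec e A) x = pd i (fun y => ∑ a, A y a • e a y) x := rfl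
  rw [h0, pd_sum i _ (g := fun a y => A y a • e a y) fun a _ => (hAd a).smul (hed a)]
  simp only [pd_smul i (hAd _) (hed _), h.pd_e x hx, hr.pd_A x hx, add_smul, neg_smul,
    Finset.sum_add_distrib, Finset.sum_neg_distrib, Finset.smul_sum, Finset.sum_smul, smul_smul,
    ite_smul, zero_smul, Finset.sum_ite_eq', Finset.mem_univ, if_true]
  rw [Finset.sum_comm]
  simp only [mul_comm (A x _)]
  abel

/-- The terms with `τ` in the derivatives of `b` and of `u` cancel. -/
theorem IsFramedSequence.pd_pairing (h : IsFramedSequence k U f u e F γ)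
    (hr : IsRealLaxSolution k U F γ m A b) {x : E n} (hx : x ∈ U) (l i : Fin n) :
    pd i (pairing b (u l)) x = -(A x (Sum.inl i) * u l x i) := by
  have hbd := fun p => differentiableAt_of_contDiffOn h.isOpen (hr.smooth_b p) hx
  have hud := fun p => differentiableAt_of_contDiffOn h.isOpen (h.smooth_u l p) hx
  have h0 : pd i (pairing b (u l)) x = pd i (fun y => ∑ p, b y p * u l y p) x := rfl
  rw [h0, pd_sum i _ (g := fun p y => b y p * u l y p) fun p _ => (hbd p).mul (hud p)]
  simp only [pd_mul i (hbd _) (hud _), h.pd_u x hx, hr.pd_b x hx, sub_mul, neg_mul, ite_mul,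
    zero_mul, Finset.sum_add_distrib, Finset.sum_sub_distrib, Finset.sum_neg_distrib,
    Finset.sum_ite_eq', Finset.mem_univ, if_true, Finset.mul_sum, Finset.sum_mul]
  rw [Finset.sum_comm]
  simp only [mul_assoc, mul_left_comm (b x _)]
  abel

theorem IsFramedSequence.pd_sqSum (h : IsFramedSequence k U f u e F γ)
    (hr : IsRealLaxSolution k U F γ m A b) {x : E n} (hx : x ∈ U) (i : Fin n) :
    pd i (fun y => ∑ a, A y a ^ 2) x = 2 * (m * (eps k i * b x i) * A x (Sum.inl i)) := by
  have hMd : DifferentiableAt ℝ (moveVec e A) x := by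
    have hAd := fun a => differentiableAt_of_contDiffOn h.isOpen (hr.smooth_A a) hx
    have hed := fun a => differentiableAt_of_contDiffOn h.isOpen (h.smooth_e a) hx
    unfold moveVec
    fun_prop
  rw [← pd_congr_of_eqOn h.isOpen (fun y hy => inner_moveVec_self (h.orthonormal y hy)) hx i,
    pd_inner i hMd hMd, h.pd_moveVec hr hx, inner_smul_left, inner_smul_right,
    inner_moveVec (h.orthonormal x hx), real_inner_comm, inner_moveVec (h.orthonormal x hx)]
  simp
  ring

/-- Obtained by differentiating `s |A|² = 2`. -/
theorem IsFramedSequence.pd_reflFactor (h : IsFramedSequence k U f u e F γ)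
    (hr : IsRealLaxSolution k U F γ m A b) {x : E n} (hx : x ∈ U) (hA : ∑ a, A x a ^ 2 ≠ 0)
    (i : Fin n) : pd i (reflFactor A) x
      = -(reflFactor A x ^ 2 * (m * (eps k i * b x i) * A x (Sum.inl i))) := by
  have hAd := fun a => differentiableAt_of_contDiffOn h.isOpen (hr.smooth_A a) hx
  have hrd : DifferentiableAt ℝ (fun y => ∑ a, A y a ^ 2) x := by fun_prop
  have hsd : DifferentiableAt ℝ (reflFactor A) x := differentiableAt_reflFactor hrd hA
  have hcont := hrd.continuousAt.eventually_ne hA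
  have h1 : pd i (fun y => reflFactor A y * ∑ a, A y a ^ 2) x = 0 := by
    rw [pd_congr (g' := fun _ => (2 : ℝ)) (hcont.mono fun y hy => ?_) i, pd_const]
    rw [reflFactor, div_mul_cancel₀ _ hy]
  rw [pd_mul i hsd hrd, h.pd_sqSum hr hx] at h1
  have h2 : reflFactor A x * ∑ a, A x a ^ 2 = 2 := by rw [reflFactor, div_mul_cancel₀ _ hA]
  have h3 : pd i (reflFactor A) x * 2
      = -(reflFactor A x ^ 2 * (m * (eps k i * b x i) * A x (Sum.inl i))) * 2 := by
    linear_combination reflFactor A x * h1 - pd i (reflFactor A) x * h2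
  linarith

theorem IsFramedSequence.pd_newSurface (h : IsFramedSequence k U f u e F γ)
    (hr : IsRealLaxSolution k U F γ m A b) {x : E n} (hx : x ∈ U) (hA : ∑ a, A x a ^ 2 ≠ 0)
    (l j : Fin n) : pd j (newSurface (f l) e A b (u l)) x
      = newMetric k m A b (u l) x j • newFrame e A (Sum.inl j) x := by
  have hAd := fun a => differentiableAt_of_contDiffOn h.isOpen (hr.smooth_A a) hx
  have hbd := fun p => differentiableAt_of_contDiffOn h.isOpen (hr.smooth_b p) hx
  have hud := fun p => differentiableAt_of_contDiffOn h.isOpen (h.smooth_u l p) hx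
  have hed := fun a => differentiableAt_of_contDiffOn h.isOpen (h.smooth_e a) hx
  have hfd := differentiableAt_of_contDiffOn h.isOpen (h.isothermic l).smooth hx
  have hrd : DifferentiableAt ℝ (fun y => ∑ a, A y a ^ 2) x := by fun_prop
  have hsd : DifferentiableAt ℝ (reflFactor A) x := differentiableAt_reflFactor hrd hA
  have hMd : DifferentiableAt ℝ (moveVec e A) x := by unfold moveVec; fun_prop
  have hφd : DifferentiableAt ℝ (pairing b (u l)) x := by unfold pairing; fun_prop
  unfold newSurface
  rw [pd_add j (g := f l)
    (g' := fun y => (reflFactor A y * pairing b (u l) y) • moveVec e A y) hfd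
      ((hsd.mul hφd).smul hMd),
    pd_smul j (c := fun y => reflFactor A y * pairing b (u l) y) (hsd.mul hφd) hMd,
    pd_mul j hsd hφd, h.pd_f x hx, h.pd_moveVec hr hx, h.pd_pairing hr hx,
    h.pd_reflFactor hr hx hA, newMetric, newFrame]
  module

theorem IsFramedSequence.null_newMetric (h : IsFramedSequence k U f u e F γ)
    (hr : IsRealLaxSolution k U F γ m A b) {x : E n} (hx : x ∈ U) (hA : ∑ a, A x a ^ 2 ≠ 0)
    (l : Fin n) : ∑ j, eps k j * newMetric k m A b (u l) x j ^ 2 = 0 := by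
  have hs : reflFactor A x * ∑ a, A x a ^ 2 = 2 := by rw [reflFactor, div_mul_cancel₀ _ hA]
  have hn := hr.null x hx
  have hu := h.null_u x hx l
  set s := reflFactor A x
  set φ := pairing b (u l) x with hφ
  have hterm : ∀ j, eps k j * newMetric k m A b (u l) x j ^ 2
      = eps k j * u l x j ^ 2 + 2 * s * m * φ * (b x j * u l x j)
        + (s * m * φ) ^ 2 * (eps k j * b x j ^ 2) := by
    intro j
    change eps k j * (u l x j + s * m * φ * (eps k j * b x j)) ^ 2 = _
    linear_combination (2 * s * m * φ * u l x j * b x j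
      + (s * m * φ) ^ 2 * b x j ^ 2 * eps k j) * eps_mul_self k j
  simp only [hterm, Finset.sum_add_distrib, ← Finset.mul_sum]
  rw [hu]
  have hφ' : ∑ j, b x j * u l x j = φ := rfl
  rw [hφ']
  linear_combination (s ^ 2 * m * φ ^ 2) * hn - s * m * φ ^ 2 * hs

/-- The map `u ↦ u + s m (bᵀ u) J b` is an involution because `m bᵀ J b = -|A|²`. -/
theorem IsFramedSequence.linearIndependent_newMetric (h : IsFramedSequence k U f u e F γ)
    (hr : IsRealLaxSolution k U F γ m A b) {x : E n} (hx : x ∈ U) (hA : ∑ a, A x a ^ 2 ≠ 0) :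
    LinearIndependent ℝ (fun l => newMetric k m A b (u l) x) := by
  have hs : reflFactor A x * ∑ a, A x a ^ 2 = 2 := by rw [reflFactor, div_mul_cancel₀ _ hA]
  have hn := hr.null x hx
  let L : (Fin n → ℝ) →ₗ[ℝ] (Fin n → ℝ) :=
    { toFun := fun w j => w j + reflFactor A x * m * (∑ p, b x p * w p) * (eps k j * b x j)
      map_add' := fun w w' => by
        ext j
        simp only [Pi.add_apply, mul_add, Finset.sum_add_distrib]
        ring
      map_smul' := fun c w => by
        ext j
        simp only [Pi.smul_apply, smul_eq_mul, RingHom.id_apply, mul_left_comm (b x _) c,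
          ← Finset.mul_sum]
        ring }
  have hinv : ∀ w, L (L w) = w := by
    intro w
    ext j
    have h1 : ∑ p, b x p * L w p = -∑ p, b x p * w p := by
      have h2 : ∀ p, b x p * L w p = b x p * w p
          + reflFactor A x * m * (∑ p, b x p * w p) * (eps k p * b x p ^ 2) := by
        intro p
        change b x p * (w p + reflFactor A x * m * (∑ p, b x p * w p) * (eps k p * b x p)) = _
        ring
      simp only [h2, Finset.sum_add_distrib, ← Finset.mul_sum]
      linear_combination (∑ p, b x p * w p) * (reflFactor A x * hn - hs)
    change L w j + reflFactor A x * m * (∑ p, b x p * L w p) * (eps k j * b x j) = w j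
    rw [h1]
    change (w j + reflFactor A x * m * (∑ p, b x p * w p) * (eps k j * b x j)) + _ = w j
    ring
  have hinj : Function.Injective L := Function.LeftInverse.injective hinv
  exact (h.independent x hx).map' L (LinearMap.ker_eq_bot.2 hinj)

theorem IsFramedSequence.pd_newFrame_normal (h : IsFramedSequence k U f u e F γ)
    (hr : IsRealLaxSolution k U F γ m A b) {x : E n} (hx : x ∈ U) (hA : ∑ a, A x a ^ 2 ≠ 0)
    (j : Fin n) : pd j (newFrame e A (Sum.inr ())) x
      = (-(eps k j * γ x j + reflFactor A x * A x (Sum.inr ()) * (m * (eps k j * b x j))))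
        • newFrame e A (Sum.inl j) x := by
  have hAd := fun a => differentiableAt_of_contDiffOn h.isOpen (hr.smooth_A a) hx
  have hed := fun a => differentiableAt_of_contDiffOn h.isOpen (h.smooth_e a) hx
  have hrd : DifferentiableAt ℝ (fun y => ∑ a, A y a ^ 2) x := by fun_prop
  have hsd : DifferentiableAt ℝ (reflFactor A) x := differentiableAt_reflFactor hrd hA
  have hMd : DifferentiableAt ℝ (moveVec e A) x := by unfold moveVec; fun_prop
  have hN : pd j (e (Sum.inr ())) x = (-(eps k j * γ x j)) • e (Sum.inl j) x := by
    rw [h.pd_e x hx, Fintype.sum_sum_type]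
    simp [omegaCoeff_inl_inr, omegaCoeff_inr_inr, ite_smul]
  have hAN : pd j (fun y => A y (Sum.inr ())) x = -(eps k j * γ x j * A x (Sum.inl j)) := by
    rw [hr.pd_A x hx, Fintype.sum_sum_type]
    simp [omegaCoeff_inr_inl, omegaCoeff_inr_inr]
  have h0 : pd j (newFrame e A (Sum.inr ())) x = pd j (fun y => e (Sum.inr ()) y
      - (reflFactor A y * A y (Sum.inr ())) • moveVec e A y) x := rfl
  rw [h0, pd_sub j (g := e (Sum.inr ()))
    (g' := fun y => (reflFactor A y * A y (Sum.inr ())) • moveVec e A y) (hed _)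
      ((hsd.mul (hAd _)).smul hMd),
    pd_smul j (c := fun y => reflFactor A y * A y (Sum.inr ())) (hsd.mul (hAd _)) hMd,
    pd_mul j hsd (hAd _), hN, hAN, h.pd_moveVec hr hx, h.pd_reflFactor hr hx hA, newFrame]
  module

end Transform

/-! ### Hypersurfaces described by a frame and metric fields -/

section Framed

variable {n k : ℕ}

/-- A map `g` on the open set `B`, not necessarily an immersion, whose partial derivatives are
`g_{x_j} = w_j e_j` for a smooth orthonormal frame with `(e_{n+1})_{x_j}` parallel to `e_j`, and
with `∑ ε_j w_j² = 0`. -/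
structure IsFramedMap (k : ℕ) (B : Set (E n)) (g : E n → E (n + 1))
    (e : FrameIdx n → E n → E (n + 1)) (w : E n → Fin n → ℝ) : Prop where
  isOpen : IsOpen B
  smooth : ContDiffOn ℝ ∞ g B
  smooth_e : ∀ a, ContDiffOn ℝ ∞ (e a) B
  smooth_w : ContDiffOn ℝ ∞ w B
  orthonormal : ∀ x ∈ B, Orthonormal ℝ (fun a => e a x)
  pd_eq : ∀ x ∈ B, ∀ j, pd j g x = w x j • e (Sum.inl j) x
  pd_normal : ∀ x ∈ B, ∀ j, ∃ c : ℝ, pd j (e (Sum.inr ())) x = c • e (Sum.inl j) x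
  null : ∀ x ∈ B, ∑ j, eps k j * w x j ^ 2 = 0

variable {B W : Set (E n)} {g : E n → E (n + 1)} {e : FrameIdx n → E n → E (n + 1)}
  {w : E n → Fin n → ℝ}

theorem isOpen_setOf_forall_ne {ι : Type*} [Finite ι] (hB : IsOpen B) {w : ι → E n → ℝ}
    (hw : ∀ i, ContinuousOn (w i) B) : IsOpen {x | x ∈ B ∧ ∀ i, w i x ≠ 0} := by
  refine isOpen_iff_mem_nhds.2 fun x hx => ?_
  refine Filter.Eventually.and (hB.mem_nhds hx.1) (eventually_all.2 fun i => ?_)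
  exact ((hw i).continuousAt (hB.mem_nhds hx.1)).eventually_ne (hx.2 i)

theorem IsCurvatureLineParam.mono (h : IsCurvatureLineParam B g) (hW : IsOpen W) (hWB : W ⊆ B) :
    IsCurvatureLineParam W g :=
  ⟨hW, h.smooth.mono hWB, fun x hx => h.immersed x (hWB hx), fun x hx => h.first_diag x (hWB hx),
    fun x hx => h.second_diag x (hWB hx)⟩

namespace IsFramedMap

theorem mono (h : IsFramedMap k B g e w) (hW : IsOpen W) (hWB : W ⊆ B) : IsFramedMap k W g e w :=
  ⟨hW, h.smooth.mono hWB, fun a => (h.smooth_e a).mono hWB, h.smooth_w.mono hWB,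
    fun x hx => h.orthonormal x (hWB hx), fun x hx => h.pd_eq x (hWB hx),
    fun x hx => h.pd_normal x (hWB hx), fun x hx => h.null x (hWB hx)⟩

theorem immersedAt_iff (h : IsFramedMap k B g e w) {x : E n} (hx : x ∈ B) :
    ImmersedAt g x ↔ ∀ j, w x j ≠ 0 := by
  have hli : LinearIndependent ℝ (fun j : Fin n => e (Sum.inl j) x) :=
    ((h.orthonormal x hx).comp _ Sum.inl_injective).linearIndependent
  have h0 : (fun j => pd j g x) = fun j => w x j • e (Sum.inl j) x := funext (h.pd_eq x hx)
  rw [ImmersedAt, h0]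
  refine ⟨fun hi j hj => hi.ne_zero j (by simp [hj]), fun hw => ?_⟩
  exact hli.units_smul fun j => Units.mk0 _ (hw j)

theorem isOpen_immersed {ι : Type*} [Finite ι] (hB : IsOpen B) {g : ι → E n → E (n + 1)}
    {w : ι → E n → Fin n → ℝ} (h : ∀ l, IsFramedMap k B (g l) e (w l)) :
    IsOpen {x | x ∈ B ∧ ∀ l, ImmersedAt (g l) x} := by
  have h1 : {x | x ∈ B ∧ ∀ l, ImmersedAt (g l) x}
      = {x | x ∈ B ∧ ∀ p : ι × Fin n, w p.1 x p.2 ≠ 0} := by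
    ext x
    simp only [mem_ofPred_eq, Prod.forall]
    exact and_congr_right fun hx => forall_congr' fun l => (h l).immersedAt_iff hx
  rw [h1]
  exact isOpen_setOf_forall_ne hB fun p =>
    (contDiffOn_pi.1 (h p.1).smooth_w p.2).continuousOn

theorem isIsothermic (h : IsFramedMap k B g e w) (hi : ∀ x ∈ B, ImmersedAt g x) :
    IsIsothermic k B g where
  isOpen := h.isOpen
  smooth := h.smooth
  immersed := hi
  first_diag x hx i j hij := by
    rw [h.pd_eq x hx, h.pd_eq x hx, inner_smul_left, inner_smul_right,
      (h.orthonormal x hx).2 (fun hc => hij (Sum.inl_injective hc))]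
    simp
  second_diag x hx ν hν i j hij := by
    have hw := (h.immersedAt_iff hx).1 (hi x hx)
    have hort := h.orthonormal x hx
    have hed := fun a => differentiableAt_of_contDiffOn h.isOpen (h.smooth_e a) hx
    have hwd := fun p => differentiableAt_of_contDiffOn h.isOpen (contDiffOn_pi.1 h.smooth_w p) hx
    have hνe : ∀ p, ⟪e (Sum.inl p) x, ν⟫ = 0 := by
      intro p
      have h1 := hν p
      rw [h.pd_eq x hx, inner_smul_left] at h1
      simpa [hw p] using h1
    -- a vector orthogonal to all tangent vectors is a multiple of the normal vector
    have hν' : ν = ⟪e (Sum.inr ()) x, ν⟫ • e (Sum.inr ()) x := by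
      have h1 := hort.sum_inner_smul ν
      rw [Fintype.sum_sum_type] at h1
      simpa [hνe] using h1
    have h2 : pd i (pd j g) x
        = pd i (fun y => w y j • e (Sum.inl j) y) x :=
      pd_congr_of_eqOn h.isOpen (fun y hy => h.pd_eq y hy j) hx i
    -- differentiate `⟨e_j, e_{n+1}⟩ = 0`
    have h3 : ⟪pd i (e (Sum.inl j)) x, e (Sum.inr ()) x⟫ = 0 := by
      have h4 : pd i (fun y => ⟪e (Sum.inl j) y, e (Sum.inr ()) y⟫) x = 0 := by
        rw [pd_congr_of_eqOn h.isOpen (g' := fun _ => (0 : ℝ))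
          (fun y hy => (h.orthonormal y hy).2 (by simp)) hx i, pd_const]
      rw [pd_inner i (hed _) (hed _)] at h4
      obtain ⟨c, hc⟩ := h.pd_normal x hx i
      rw [hc, inner_smul_right,
        hort.2 (fun hc => hij (Sum.inl_injective hc).symm)] at h4
      simpa using h4
    rw [h2, pd_smul i (hwd j) (hed _), inner_add_left, inner_smul_left, inner_smul_left, hνe, hν',
      inner_smul_right, h3]
    simp
  guichard x hx := by
    rw [← h.null x hx]
    refine Finset.sum_congr rfl fun j _ => ?_
    rw [h.pd_eq x hx, inner_smul_left, inner_smul_right, real_inner_self_eq_norm_sq,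
      (h.orthonormal x hx).1]
    simp [pow_two]

theorem isCombescureSequence {g : Fin n → E n → E (n + 1)}
    {w : Fin n → E n → Fin n → ℝ}
    (h : ∀ l, IsFramedMap k B (g l) e (w l)) (hi : ∀ x ∈ B, ∀ l, ImmersedAt (g l) x)
    (hw : ∀ x ∈ B, LinearIndependent ℝ (fun l => w l x)) : IsCombescureSequence k B g := by
  have hne : ∀ l, ∀ x ∈ B, ∀ j, w l x j ≠ 0 := fun l x hx =>
    ((h l).immersedAt_iff hx).1 (hi x hx l)
  refine ⟨fun l => (h l).isIsothermic fun x hx => hi x hx l, fun l m _ x hx j => ?_, w,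
    ⟨fun l => (h l).smooth_w, fun l x hx j => ?_, fun l m x hx j => ?_⟩, hw⟩
  · refine ⟨w m x j / w l x j, ?_⟩
    rw [(h m).pd_eq x hx, (h l).pd_eq x hx, smul_smul, div_mul_cancel₀ _ (hne l x hx j)]
  · rw [(h l).pd_eq x hx, inner_smul_left, inner_smul_right, real_inner_self_eq_norm_sq,
      ((h l).orthonormal x hx).1]
    simp [pow_two]
  · rw [(h m).pd_eq x hx, (h l).pd_eq x hx, inv_smul_smul₀ (hne l x hx j),
      inv_smul_smul₀ (hne m x hx j)]

theorem isAdaptedFrame (h : IsFramedMap k B g e w) : IsAdaptedFrame B g e :=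
  ⟨h.smooth_e, h.orthonormal, fun x hx j => ⟨w x j, h.pd_eq x hx j⟩⟩

end IsFramedMap

end Framed

/-! ### The transformed hypersurfaces -/

section Transformed

variable {n k : ℕ} {U B : Set (E n)} {f : Fin n → E n → E (n + 1)} {u : Fin n → E n → Fin n → ℝ}
  {e : FrameIdx n → E n → E (n + 1)} {F : E n → Matrix (Fin n) (Fin n) ℝ} {γ : E n → Fin n → ℝ}
  {m : ℝ} {A : E n → FrameIdx n → ℝ} {b : E n → Fin n → ℝ}

theorem contDiffOn_reflFactor (hAs : ∀ a, ContDiffOn ℝ ∞ (fun x => A x a) B)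
    (hA : ∀ x ∈ B, ∑ a, A x a ^ 2 ≠ 0) : ContDiffOn ℝ ∞ (reflFactor A) B :=
  (contDiffOn_const (c := (2 : ℝ))).div (ContDiffOn.sum fun a _ => (hAs a).pow 2) hA

theorem contDiffOn_moveVec (hAs : ∀ a, ContDiffOn ℝ ∞ (fun x => A x a) B)
    (hes : ∀ a, ContDiffOn ℝ ∞ (e a) B) : ContDiffOn ℝ ∞ (moveVec e A) B :=
  ContDiffOn.sum fun a _ => (hAs a).smul (hes a)

theorem IsFramedSequence.isFramedMap_newSurface (h : IsFramedSequence k U f u e F γ)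
    (hr : IsRealLaxSolution k U F γ m A b) (hB : IsOpen B) (hBU : B ⊆ U)
    (hA : ∀ x ∈ B, ∑ a, A x a ^ 2 ≠ 0) (l : Fin n) :
    IsFramedMap k B (newSurface (f l) e A b (u l)) (newFrame e A) (newMetric k m A b (u l)) := by
  have hAs := fun a => (hr.smooth_A a).mono hBU
  have hbs := fun p => (hr.smooth_b p).mono hBU
  have hus := fun p => (h.smooth_u l p).mono hBU
  have hes := fun a => (h.smooth_e a).mono hBU
  have hss := contDiffOn_reflFactor hAs hA
  have hMs := contDiffOn_moveVec hAs hes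
  have hφs : ContDiffOn ℝ ∞ (pairing b (u l)) B := ContDiffOn.sum fun p _ => (hbs p).mul (hus p)
  exact
    { isOpen := hB
      smooth := ((h.isothermic l).smooth.mono hBU).add ((hss.mul hφs).smul hMs)
      smooth_e := fun a => (hes a).sub ((hss.mul (hAs a)).smul hMs)
      smooth_w := contDiffOn_pi.2 fun j => (hus j).add
        (((hss.mul contDiffOn_const).mul hφs).mul (contDiffOn_const.mul (hbs j)))
      orthonormal := fun x hx => orthonormal_newFrame (h.orthonormal x (hBU hx)) (hA x hx)
      pd_eq := fun x hx j => h.pd_newSurface hr (hBU hx) (hA x hx) l j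
      pd_normal := fun x hx j => ⟨_, h.pd_newFrame_normal hr (hBU hx) (hA x hx) j⟩
      null := fun x hx => h.null_newMetric hr (hBU hx) (hA x hx) l }

theorem IsFramedMap.congr {w : E n → Fin n → ℝ} {g g' : E n → E (n + 1)}
    (h : IsFramedMap k B g e w) (hg : EqOn g' g B) : IsFramedMap k B g' e w :=
  { h with
    smooth := h.smooth.congr hg
    pd_eq := fun x hx j => (pd_congr_of_eqOn h.isOpen hg hx j).trans (h.pd_eq x hx j) }

/-- Corresponding frame lines of `f_ℓ` and of its transform meet at distance `(bᵀ u_ℓ) / A_a`, since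
both the displacement and `e_a - ẽ_a` are multiples of `∑ A_a e_a`. -/
theorem IsFramedSequence.isRibaucourTransform (h : IsFramedSequence k U f u e F γ)
    (hr : IsRealLaxSolution k U F γ m A b) (hBU : B ⊆ U) {l : Fin n} {g : E n → E (n + 1)}
    {w : E n → Fin n → ℝ} (hg : IsFramedMap k B g (newFrame e A) w)
    (hgB : EqOn g (newSurface (f l) e A b (u l)) B) (hi : ∀ x ∈ B, ImmersedAt g x)
    (hA : ∀ x ∈ B, ∀ a, A x a ≠ 0) : IsRibaucourTransform B (f l) g := by
  refine ⟨(h.isothermic l).toIsCurvatureLineParam.mono hg.isOpen hBU,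
    (hg.isIsothermic hi).toIsCurvatureLineParam, e, newFrame e A,
    fun a x => pairing b (u l) x / A x a,
    ⟨fun a => (h.smooth_e a).mono hBU, fun x hx => h.orthonormal x (hBU hx),
      fun x hx j => ⟨_, h.pd_f x (hBU hx) l j⟩⟩, hg.isAdaptedFrame, fun a => ?_,
    fun x hx a => ?_⟩
  · refine ContDiffOn.div (ContDiffOn.sum fun p _ => ?_) ((hr.smooth_A a).mono hBU)
      fun x hx => hA x hx a
    exact ((hr.smooth_b p).mono hBU).mul ((h.smooth_u l p).mono hBU)
  · have h1 : pairing b (u l) x / A x a * (reflFactor A x * A x a)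
        = reflFactor A x * pairing b (u l) x := by
      have := hA x hx a
      field_simp
    rw [hgB hx, newSurface, newFrame, smul_sub, smul_smul, h1]
    abel

end Transformed

/-! ### Normalized generators -/

section Normalized

variable {n k : ℕ} {α : ℂ} {w : BigIdx n → ℂ}

theorem IsRealIsotropic.sum_sq_pos (hw : IsRealIsotropic k α w) (hm : LineMoved w) :
    0 < ∑ a, (w (Sum.inl a)).re ^ 2 := by
  obtain ⟨⟨a, ha⟩, -⟩ := (lineMoved_iff w).1 hm
  have h1 : (w (Sum.inl a)).re ≠ 0 := fun h0 => ha (by rw [hw.upper_eq a, h0]; simp)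
  exact Finset.sum_pos' (fun _ _ => sq_nonneg _) ⟨a, Finset.mem_univ _, by positivity⟩

theorem IsRealIsotropic.exists_normalized (hw : IsRealIsotropic k α w) (hm : LineMoved w) :
    ∃ Q Z, IsNormalizedGenerator k α w Q Z := by
  have hpos := hw.sum_sq_pos hm
  set S := ∑ a, (w (Sum.inl a)).re ^ 2 with hS
  set c : ℝ := √(2 / S) with hc
  have hc2 : c ^ 2 = 2 / S := Real.sq_sqrt (by positivity)
  have hc0 : c ≠ 0 := by positivity
  have hc0' : (c : ℂ) ≠ 0 := by exact_mod_cast hc0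
  have hcS : c ^ 2 * S = 2 := by rw [hc2]; field_simp
  refine ⟨fun a => c * (w (Sum.inl a)).re, fun p => c * w (Sum.inr p), ?_, ?_, ?_, ?_, ?_⟩
  · refine Submodule.span_singleton_eq_span_singleton.2 ⟨Units.mk0 (c : ℂ) hc0', ?_⟩
    ext (a | p)
    · simp [Units.smul_def, ← hw.upper_eq a]
    · simp [Units.smul_def]
  · simp only [mul_pow, ← Finset.mul_sum]
    exact hcS
  · have h1 := hw.isotropic
    have h2 : ∑ a, w (Sum.inl a) * w (Sum.inl a) = (S : ℂ) := by
      rw [hS]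
      push_cast
      refine Finset.sum_congr rfl fun a _ => ?_
      conv_lhs => rw [hw.upper_eq a]
      ring
    rw [bigForm, h2] at h1
    have h3 : ∀ p, (eps k p : ℂ) * (c * w (Sum.inr p)) ^ 2
        = (c : ℂ) ^ 2 * ((eps k p : ℂ) * w (Sum.inr p) * w (Sum.inr p)) := fun p => by ring
    have h4 : (c : ℂ) ^ 2 * S = 2 := by exact_mod_cast hcS
    simp only [h3, ← Finset.mul_sum]
    linear_combination (c : ℂ) ^ 2 * h1 - h4
  · intro hα p
    rcases hw.reality with ⟨-, h2⟩ | ⟨h1, -⟩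
    · simp [h2 p]
    · exact absurd (Complex.ext h1 hα) hw.param_ne_zero
  · intro hα p
    rcases hw.reality with ⟨h1, -⟩ | ⟨-, h2⟩
    · exact absurd (Complex.ext hα h1) hw.param_ne_zero
    · simp [h2 p]

/-- Normalized generators are real multiples of any generator which satisfies the reality
condition. -/
theorem IsNormalizedGenerator.exists_scale (hw : IsRealIsotropic k α w) (hm : LineMoved w)
    {Q : FrameIdx n → ℝ} {Z : Fin n → ℂ} (h : IsNormalizedGenerator k α w Q Z) :
    ∃ c : ℝ, c ≠ 0 ∧ c ^ 2 = 2 / ∑ a, (w (Sum.inl a)).re ^ 2 ∧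
      (∀ a, Q a = c * (w (Sum.inl a)).re) ∧
      ∀ u : Fin n → ℝ, coefficient α Z u
        = ((c * ∑ p, (w (Sum.inr p) / α).re * u p : ℝ) : ℂ) := by
  obtain ⟨z, hz⟩ := Submodule.span_singleton_eq_span_singleton.1 h.span_eq
  have hup : ∀ a, (Q a : ℂ) = z * ((w (Sum.inl a)).re : ℂ) := by
    intro a
    rw [← hw.upper_eq a]
    exact (congrFun hz (Sum.inl a)).symm
  have hlow : ∀ p, Z p = z * w (Sum.inr p) := fun p => (congrFun hz (Sum.inr p)).symm
  obtain ⟨⟨a, ha⟩, -⟩ := (lineMoved_iff w).1 hm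
  have hre : (w (Sum.inl a)).re ≠ 0 := fun h0 => ha (by rw [hw.upper_eq a, h0]; simp)
  -- the factor is real because it is a quotient of two real coordinates
  have hzc : ((Q a / (w (Sum.inl a)).re : ℝ) : ℂ) = z := by
    have h1 : ((w (Sum.inl a)).re : ℂ) ≠ 0 := by exact_mod_cast hre
    rw [Complex.ofReal_div, hup a, mul_div_cancel_right₀ _ h1]
  set c : ℝ := Q a / (w (Sum.inl a)).re
  have hQ : ∀ a, Q a = c * (w (Sum.inl a)).re := by
    intro a
    have h1 := hup a
    rw [← hzc] at h1
    exact_mod_cast h1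
  have hsum : c ^ 2 * ∑ a, (w (Sum.inl a)).re ^ 2 = 2 := by
    rw [← h.norm_Q, Finset.mul_sum]
    exact Finset.sum_congr rfl fun a _ => by rw [hQ a]; ring
  refine ⟨c, ?_, eq_div_of_mul_eq (hw.sum_sq_pos hm).ne' hsum, hQ, fun v => ?_⟩
  · rintro h0
    rw [h0] at hsum
    norm_num at hsum
  · have h1 : ∀ p, Z p * (v p : ℂ)
        = α * (c * ((((w (Sum.inr p) / α).re : ℝ) : ℂ) * (v p : ℂ))) := by
      intro p
      rw [hlow p, ← hzc]
      conv_lhs => rw [hw.lower_eq p]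
      ring
    simp only [coefficient, h1, ← Finset.mul_sum]
    rw [mul_div_cancel_left₀ _ hw.param_ne_zero]
    push_cast
    rfl

end Normalized

theorem isOpen_setOf_lineMoved {n : ℕ} {U : Set (E n)} (hU : IsOpen U) {y : E n → BigIdx n → ℂ}
    (hy : ∀ x ∈ U, ContinuousAt y x) : IsOpen {x | x ∈ U ∧ LineMoved (y x)} := by
  refine isOpen_iff_mem_nhds.2 fun x hx => ?_
  obtain ⟨⟨a, ha⟩, p, hp⟩ := (lineMoved_iff _).1 hx.2
  have hc := fun c => (continuousAt_pi.1 (hy x hx.1) c).eventually_ne (y := 0)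
  filter_upwards [hU.mem_nhds hx.1, hc _ ha, hc _ hp] with z hz h1 h2
  exact ⟨hz, (lineMoved_iff _).2 ⟨⟨a, h1⟩, p, h2⟩⟩

end Isothermic

open Isothermic in
theorem mainTheorem7 {n k : ℕ} (hk : 1 ≤ k) (hkn : k < n)
    (U : Set (E n)) (hU : IsOpen U) (hUsc : IsSimplyConnected U) (hU0 : (0 : E n) ∈ U)
    (f : Fin n → E n → E (n + 1)) (hf : IsCombescureSequence k U f)
    (hf0 : ∀ l, f l 0 = 0)
    (f₁ : E n → E (n + 1)) (hf₁ : f₁ = f ⟨0, Nat.zero_lt_of_lt hkn⟩)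
    (haxes : ∀ i : Fin n, ∃ c : ℝ,
      pd i f₁ 0 = c • (EuclideanSpace.single i.castSucc 1 : E (n + 1)))
    (u : Fin n → E n → Fin n → ℝ) (hu : IsMetricFields U f u)
    (u₁ : E n → Fin n → ℝ) (hu₁ : u₁ = u ⟨0, Nat.zero_lt_of_lt hkn⟩)
    (N : E n → E (n + 1)) (hN : IsUnitNormal U f₁ N)
    (F : E n → Matrix (Fin n) (Fin n) ℝ) (hF : F = assocF k u₁)
    (γ : E n → Fin n → ℝ) (hγ : γ = assocGamma k f₁ N u₁)
    (e : FrameIdx n → E n → E (n + 1)) (he : e = frame f₁ N u₁)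
    (α : ℂ) (v : BigIdx n → ℂ) (hv : IsRealIsotropic k α v) (hρ : LineMoved v) :
    IsSystemSolution k U F γ ∧
    (∃ y : E n → BigIdx n → ℂ, IsLaxSolution k U F γ α v y) ∧
    (∀ y y' : E n → BigIdx n → ℂ, IsLaxSolution k U F γ α v y → IsLaxSolution k U F γ α v y' →
      Set.EqOn y y' U) ∧
    ∀ y : E n → BigIdx n → ℂ, IsLaxSolution k U F γ α v y →
      (∀ x ∈ U, IsRealIsotropic k α (y x)) ∧
      ∀ B : Set (E n), B = {x | x ∈ U ∧ LineMoved (y x)} →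
        IsOpen B ∧ (0 : E n) ∈ B ∧
        (∀ x ∈ B, ∃ (Q : FrameIdx n → ℝ) (Z : Fin n → ℂ),
          IsNormalizedGenerator k α (y x) Q Z) ∧
        ∀ (Q : E n → FrameIdx n → ℝ) (Z : E n → Fin n → ℂ),
          (∀ x ∈ B, IsNormalizedGenerator k α (y x) (Q x) (Z x)) →
          ∀ f' : Fin n → E n → E (n + 1), (∀ l, f' l = transform α (f l) (u l) e Q Z) →
            (∀ l, ∀ x ∈ B, (coefficient α (Z x) (u l x)).im = 0) ∧
            (∀ l, ContDiffOn ℝ ∞ (f' l) B) ∧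
            (∀ l, IsRibaucourTransform {x | x ∈ B ∧ ImmersedAt (f' l) x ∧ ∀ a, Q x a ≠ 0}
              (f l) (f' l)) ∧
            (∀ l, IsIsothermic k {x | x ∈ B ∧ ImmersedAt (f' l) x} (f' l)) ∧
            IsCombescureSequence k {x | x ∈ B ∧ ∀ l, ImmersedAt (f' l) x} f' ∧
            (∃ (e' : FrameIdx n → E n → E (n + 1)) (u' : Fin n → E n → Fin n → ℝ),
              (∀ a, ContDiffOn ℝ ∞ (e' a) B) ∧ (∀ l, ContDiffOn ℝ ∞ (u' l) B) ∧
              ∀ x ∈ B, Orthonormal ℝ (fun a => e' a x) ∧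
                (∀ l j, pd j (f' l) x = u' l x j • e' (Sum.inl j) x) ∧
                (∀ l, ∑ j, eps k j * u' l x j ^ 2 = 0) ∧
                LinearIndependent ℝ (fun l => u' l x) ∧
                (∀ j, ∃ c : ℝ, pd j (e' (Sum.inr ())) x = c • e' (Sum.inl j) x) ∧
                (∀ l a, Q x a • (f' l x - f l x) =
                  (coefficient α (Z x) (u l x)).re • (e a x - e' a x))) := by
  subst hf₁ hu₁ hF hγ he
  have h := isFramedSequence_of_combescure hf hu _ hN
  set F := assocF k (u ⟨0, Nat.zero_lt_of_lt hkn⟩)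
  set γ := assocGamma k (f ⟨0, Nat.zero_lt_of_lt hkn⟩) N (u ⟨0, Nat.zero_lt_of_lt hkn⟩)
  set e := frame (f ⟨0, Nat.zero_lt_of_lt hkn⟩) N (u ⟨0, Nat.zero_lt_of_lt hkn⟩)
  obtain ⟨hex, huniq⟩ := h.lax_existsUnique hUsc hU0 α
  refine ⟨h.isSystemSolution, hex v,
    fun y y' hy hy' => huniq v v y y' hy hy' 0 hU0 (hy.initial.trans hy'.initial.symm),
    fun y hy => ?_⟩
  have hre : ∀ x ∈ U, IsRealIsotropic k α (y x) := fun x hx => h.isRealIsotropic hUsc hU0 hv hy hx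
  refine ⟨hre, fun B hB => ?_⟩
  have hmem : ∀ x ∈ B, x ∈ U ∧ LineMoved (y x) := fun x hx => by rwa [hB] at hx
  have hBU : B ⊆ U := fun x hx => (hmem x hx).1
  have hBo : IsOpen B := by
    rw [hB]
    exact isOpen_setOf_lineMoved hU fun x hx => (hy.differentiable x hx).continuousAt
  refine ⟨hBo, ?_, fun x hx => (hre x (hBU hx)).exists_normalized (hmem x hx).2,
    fun Q Z hQZ f' hf' => ?_⟩
  · rw [hB]
    exact ⟨hU0, by rwa [hy.initial]⟩
  have hr := h.isRealLaxSolution hy hre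
  set A : E n → FrameIdx n → ℝ := fun x a => (y x (Sum.inl a)).re with hAdef
  set b : E n → Fin n → ℝ := fun x p => (y x (Sum.inr p) / α).re with hbdef
  have hA : ∀ x ∈ B, ∑ a, A x a ^ 2 ≠ 0 := fun x hx =>
    ((hre x (hBU hx)).sum_sq_pos (hmem x hx).2).ne'
  have hscale : ∀ x ∈ B, ∃ c : ℝ, c ≠ 0 ∧ c ^ 2 = reflFactor A x ∧ (∀ a, Q x a = c * A x a) ∧
      ∀ w : Fin n → ℝ, coefficient α (Z x) w = ((c * ∑ p, b x p * w p : ℝ) : ℂ) := fun x hx =>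
    (hQZ x hx).exists_scale (hre x (hBU hx)) (hmem x hx).2
  -- the normalizing factor enters the transform only through its square `2 / |A|²`
  have hEq : ∀ l, Set.EqOn (f' l) (newSurface (f l) e A b (u l)) B := by
    intro l x hx
    obtain ⟨c, -, hc2, hQ, hcoef⟩ := hscale x hx
    rw [hf' l, transform, newSurface, hcoef, Complex.ofReal_re, ← hc2, moveVec]
    simp only [hQ, mul_smul, ← Finset.smul_sum, pairing]
    module
  have hmap : ∀ l, IsFramedMap k B (f' l) (newFrame e A) (newMetric k (α ^ 2).re A b (u l)) :=
    fun l => (h.isFramedMap_newSurface hr hBo hBU hA l).congr (hEq l)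
  have hQA : ∀ x ∈ B, ∀ a, Q x a ≠ 0 ↔ A x a ≠ 0 := by
    intro x hx a
    obtain ⟨c, hc0, -, hQ, -⟩ := hscale x hx
    simp [hQ a, hc0]
  have hIo : ∀ l, IsOpen {x | x ∈ B ∧ ImmersedAt (f' l) x} := fun l => by
    simpa using IsFramedMap.isOpen_immersed (ι := Unit) hBo fun _ => hmap l
  refine ⟨fun l x hx => ?_, fun l => (hmap l).smooth, fun l => ?_, fun l => ?_, ?_,
    newFrame e A, fun l => newMetric k (α ^ 2).re A b (u l), fun a => ?_,
    fun l => (hmap l).smooth_w, fun x hx => ⟨?_, fun l j => (hmap l).pd_eq x hx j,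
      fun l => (hmap l).null x hx, h.linearIndependent_newMetric hr (hBU hx) (hA x hx),
      fun j => ⟨_, h.pd_newFrame_normal hr (hBU hx) (hA x hx) j⟩, fun l a => ?_⟩⟩
  · obtain ⟨c, -, -, -, hcoef⟩ := hscale x hx
    rw [hcoef, Complex.ofReal_im]
  · have hset : {x | x ∈ B ∧ ImmersedAt (f' l) x ∧ ∀ a, Q x a ≠ 0}
        = {x | x ∈ {x | x ∈ B ∧ ImmersedAt (f' l) x} ∧ ∀ a, A x a ≠ 0} := by
      ext x
      refine ⟨fun hx => ⟨⟨hx.1, hx.2.1⟩, fun a => (hQA x hx.1 a).1 (hx.2.2 a)⟩,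
        fun hx => ⟨hx.1.1, hx.1.2, fun a => (hQA x hx.1.1 a).2 (hx.2 a)⟩⟩
    have hsub : {x | x ∈ {x | x ∈ B ∧ ImmersedAt (f' l) x} ∧ ∀ a, A x a ≠ 0} ⊆ B :=
      fun x hx => hx.1.1
    have hopen : IsOpen {x | x ∈ {x | x ∈ B ∧ ImmersedAt (f' l) x} ∧ ∀ a, A x a ≠ 0} :=
      isOpen_setOf_forall_ne (hIo l) (w := fun a x => A x a) fun a =>
        ((hr.smooth_A a).mono fun x hx => hBU hx.1).continuousOn
    rw [hset]
    exact h.isRibaucourTransform hr (hsub.trans hBU) ((hmap l).mono hopen hsub)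
      ((hEq l).mono hsub) (fun x hx => hx.1.2) fun x hx => hx.2
  · exact ((hmap l).mono (hIo l) fun x hx => hx.1).isIsothermic fun x hx => hx.2
  · exact IsFramedMap.isCombescureSequence
      (fun l => (hmap l).mono (IsFramedMap.isOpen_immersed hBo hmap) fun x hx => hx.1)
      (fun x hx => hx.2) fun x hx => h.linearIndependent_newMetric hr (hBU hx.1) (hA x hx.1)
  · exact (hmap ⟨0, Nat.zero_lt_of_lt hkn⟩).smooth_e a
  · exact (hmap ⟨0, Nat.zero_lt_of_lt hkn⟩).orthonormal x hx
  · obtain ⟨c, -, hc2, hQ, hcoef⟩ := hscale x hx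
    rw [hEq l hx, newSurface, newFrame, hcoef, Complex.ofReal_re, hQ, ← hc2, pairing]
    module
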